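/- Let $r\in\mathbb N=\{1,2,\dots\}$ and $M>0$. For $d\in\mathbb N$ let $$F^d_{r,M}=\Big\{\textstyle\bigotimes_{i=1}^d f_i \;\Big|\; f_i:[0,1]\to[-1,1],\ f_i\in W^r_\infty([0,1]),\ \|f_i^{(r)}\|_\infty\le M\Big\},$$ where $(\bigotimes_{i=1}^d f_i)(x)=\prod_{i=1}^d f_i(x_i)$ for $x\in[0,1]^d$, $f_i^{(r)}$ is the $r$th weak derivative, and $f_i$ is the continuous representative of its class. A deterministic adaptive algorithm using $n$ function values is a map $A(f)=\phi(f(x_1),\dots,f(x_n))$ with an arbitrary $\phi:\mathbb R^n\to L_\infty([0,1]^d)$, where each point $x_k\in[0,1]^d$ may depend on the values $f(x_1),\dots,f(x_{k-1})$. Its worst case error is $e(A)=\sup_{f\in F^d_{r,M}}\|f-A(f)\|_\infty$. Let $e(n,d)$ be the infimum of $e(A)$ over all such algorithms using at most $n$ function values, and let $n(\varepsilon,d)=\inf\{n\mid e(n,d)\le\varepsilon\}$. The uniform recovery problem on $F^d_{r,M}$ - is strongly polynomially tractable if there are $c,p>0$ with $n(\varepsilon,d)\le c\,\varepsilon^{-p}$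 for all $\varepsilon\in(0,1)$, $d\in\mathbb N$; - is polynomially tractable if there are $c,q,p>0$ with $n(\varepsilon,d)\le c\,\varepsilon^{-p}d^{q}$ for all $\varepsilon\in(0,1)$, $d\in\mathbb N$; - is quasi-polynomially tractable if there are $c,t>0$ with $n(\varepsilon,d)\le c\exp\big(t(1+\ln(\varepsilon^{-1}))(1+\ln d)\big)$ for all $\varepsilon\in(0,1)$, $d\in\mathbb N$; - suffers from the curse of dimensionality if there are $\varepsilon>0$, $c>0$, $\alpha>1$ with $n(\varepsilon,d)\ge c\,\alpha^d$ for all $d\in\mathbb N$. **Theorem.** The problem suffers from the curse of dimensionality if and only if $M\ge 2^r r!$. If $M\in(r!,2^r r!)$, it is quasi-polynomially tractable but not polynomially tractable. If $M\in(0,r!]$, it is polynomially tractable but not strongly polynomially tractable. -/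

import Mathlib

open MeasureTheory Set
open scoped ENNReal

namespace RankOneRecovery

/-- The function `g` is a weak derivative of order `k` of `f` on the open interval `(0,1)`: both
are locally integrable there and `∫ f φ⁽ᵏ⁾ = (-1)ᵏ ∫ g φ` for all smooth `φ` with compact support
in `(0,1)`. -/
def HasWeakDeriv (k : ℕ) (f g : ℝ → ℝ) : Prop :=
  LocallyIntegrableOn f (Ioo 0 1) ∧ LocallyIntegrableOn g (Ioo 0 1) ∧
  ∀ φ : ℝ → ℝ, ContDiff ℝ ((⊤ : ℕ∞) : WithTop ℕ∞) φ → HasCompactSupport φ →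
    tsupport φ ⊆ Ioo 0 1 →
    ∫ x in Ioo (0 : ℝ) 1, f x * iteratedDeriv k φ x
      = (-1) ^ k * ∫ x in Ioo (0 : ℝ) 1, g x * φ x

/-- The Sobolev space `W^r_∞([0,1])`: weak derivatives up to order `r` exist and belong to
`L_∞`. For `r ≥ 1` every class has a unique representative that is continuous on `[0,1]`, and
function values are those of this representative. (Functions are total on `ℝ`, but only their
restriction to `[0,1]` matters.) -/
def sobolev (r : ℕ) : Set (ℝ → ℝ) :=
  {f | ContinuousOn f (Icc 0 1) ∧
    ∀ k ≤ r, ∃ g : ℝ → ℝ, HasWeakDeriv k f g ∧ MemLp g ⊤ (volume.restrict (Ioo (0 : ℝ) 1))}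

/-- The admissible factors: `f : [0,1] → [-1,1]` in `W^r_∞([0,1])` with `‖f⁽ʳ⁾‖_∞ ≤ M`. -/
def factorClass (r : ℕ) (M : ℝ) : Set (ℝ → ℝ) :=
  {f | f ∈ sobolev r ∧ (∀ x ∈ Icc (0 : ℝ) 1, f x ∈ Icc (-1 : ℝ) 1) ∧
    ∃ g : ℝ → ℝ, HasWeakDeriv r f g ∧
      eLpNorm g ⊤ (volume.restrict (Ioo (0 : ℝ) 1)) ≤ ENNReal.ofReal M}

/-- The unit cube `[0,1]^d`, with Lebesgue measure as its `volume`. -/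
abbrev Cube (d : ℕ) : Type := Fin d → unitInterval

/-- The class `F^d_{r,M}` of rank one tensors on `[0,1]^d`. -/
def tensorClass (r : ℕ) (M : ℝ) (d : ℕ) : Set (Cube d → ℝ) :=
  {f | ∃ F : Fin d → ℝ → ℝ, (∀ i, F i ∈ factorClass r M) ∧
    f = fun x => ∏ i, F i (x i : ℝ)}

/-- A deterministic adaptive algorithm using `n` function values: `node k` chooses the sample point
with (zero-based) index `k` from the `k` values already known (only `k < n` is used), and `output`
maps the `n` values to an element of `L_∞([0,1]^d)`. -/
structure Algorithm (d n : ℕ) where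
  node : (k : ℕ) → (Fin k → ℝ) → Cube d
  output : (Fin n → ℝ) → Lp ℝ ⊤ (volume : Measure (Cube d))

/-- The first `k` function values that the algorithm obtains for the input `f`. -/
def Algorithm.values {d n : ℕ} (A : Algorithm d n) (f : Cube d → ℝ) : (k : ℕ) → Fin k → ℝ
  | 0 => Fin.elim0
  | k + 1 => Fin.snoc (α := fun _ => ℝ) (A.values f k) (f (A.node k (A.values f k)))

/-- The approximation `A(f) = φ(f(x₁), …, f(xₙ))`. -/
def Algorithm.run {d n : ℕ} (A : Algorithm d n) (f : Cube d → ℝ) :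
    Lp ℝ ⊤ (volume : Measure (Cube d)) :=
  A.output (A.values f n)

/-- The worst case error `sup_{f ∈ F^d_{r,M}} ‖f - A(f)‖_∞`. -/
noncomputable def worstCaseError (r : ℕ) (M : ℝ) {d n : ℕ} (A : Algorithm d n) : ℝ≥0∞ :=
  ⨆ f ∈ tensorClass r M d, eLpNorm (fun x => f x - A.run f x) ⊤ (volume : Measure (Cube d))

/-- The `n`-th minimal worst case error `e(n,d)`: the infimum over all deterministic adaptive
algorithms that use at most `n` function values. -/
noncomputable def minimalError (r : ℕ) (M : ℝ) (n d : ℕ) : ℝ≥0∞ :=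
  ⨅ (m : ℕ) (_ : m ≤ n) (A : Algorithm d m), worstCaseError r M A

/-- The information complexity `n(ε,d) = inf {n | e(n,d) ≤ ε}` (the infimum of the empty set
is `⊤`). -/
noncomputable def complexity (r : ℕ) (M : ℝ) (ε : ℝ) (d : ℕ) : ℕ∞ :=
  ⨅ (n : ℕ) (_ : minimalError r M n d ≤ ENNReal.ofReal ε), (n : ℕ∞)

/-- Strong polynomial tractability: `n(ε,d) ≤ c ε^{-p}`. -/
def StronglyPolynomiallyTractable (r : ℕ) (M : ℝ) : Prop :=
  ∃ c > (0 : ℝ), ∃ p > (0 : ℝ), ∀ ε ∈ Ioo (0 : ℝ) 1, ∀ d : ℕ, 1 ≤ d →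
    (complexity r M ε d : ℝ≥0∞) ≤ ENNReal.ofReal (c * ε ^ (-p))

/-- Polynomial tractability: `n(ε,d) ≤ c ε^{-p} d^q`. -/
def PolynomiallyTractable (r : ℕ) (M : ℝ) : Prop :=
  ∃ c > (0 : ℝ), ∃ q > (0 : ℝ), ∃ p > (0 : ℝ), ∀ ε ∈ Ioo (0 : ℝ) 1, ∀ d : ℕ, 1 ≤ d →
    (complexity r M ε d : ℝ≥0∞) ≤ ENNReal.ofReal (c * ε ^ (-p) * (d : ℝ) ^ q)

/-- Quasi-polynomial tractability: `n(ε,d) ≤ c exp (t (1 + ln ε⁻¹) (1 + ln d))`. -/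
def QuasiPolynomiallyTractable (r : ℕ) (M : ℝ) : Prop :=
  ∃ c > (0 : ℝ), ∃ t > (0 : ℝ), ∀ ε ∈ Ioo (0 : ℝ) 1, ∀ d : ℕ, 1 ≤ d →
    (complexity r M ε d : ℝ≥0∞) ≤
      ENNReal.ofReal (c * Real.exp (t * (1 + Real.log ε⁻¹) * (1 + Real.log d)))

/-- The curse of dimensionality: for some `ε > 0`, `c > 0`, `α > 1` one has `n(ε,d) ≥ c α^d`
for all dimensions `d`. -/
def CurseOfDimensionality (r : ℕ) (M : ℝ) : Prop :=
  ∃ ε > (0 : ℝ), ∃ c > (0 : ℝ), ∃ α > (1 : ℝ), ∀ d : ℕ, 1 ≤ d →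
    ENNReal.ofReal (c * α ^ d) ≤ (complexity r M ε d : ℝ≥0∞)

end RankOneRecovery

/-! Put κ = M/r!. Interpolation of a factor at r nodes z has error at most κ ∏ |x - z|
(`abs_sub_sum_basis_le`). Hence the values on a fine grid nearly determine a factor, and if |f(x)| ≥
κ ρ^r, then f vanishes at fewer than r grid points within distance ρ of x (`card_zeros_lt`): a
factor that is large somewhere is nonzero at many grid points.

Upper bounds: suppose a probability weight on the grid gives weight at least (1 - 1/(2d)) |F(x)|^B
to the support of every factor F with |F(x)| > ε/2. Then a tensor of norm above ε/2 has a support of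
product weight at least (ε/2)^B / 2. There are at most 2^(md) support patterns, so few points hit
them all (`exists_detecting_points`). Once a point with nonzero value is known, the grid lines
through it recover the tensor (`abs_sub_le_of_agree_on_lines`). If κ ≤ 1, the uniform weight works
with B = 1. If κ < 2^r, some b > 1/2 has κ b^r < 1, and a factor that reaches κ b^r anywhere has few
grid zeros in (1 - b, b); mixing a central weight with the uniform one gives B of order 1 + log d
(`exists_weight_of_lt`).

Lower bounds: points at which both f and -f vanish cannot tell them apart. Tensors of truncated
powers living to the left or right of a point a have disjoint supports, one for each set of
coordinates (`card_le_complexity`). If κ ≥ 2^r, a = 1/2 gives 2^d of them with norm 1. If 1 < κ <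
2^r, only left pieces can be made to reach 1, and using at most k right pieces gives binomially many
tensors of norm bounded below. If κ ≤ 1, two nontrivial factors and a pigeonhole argument on
coordinates still force logarithmic growth in d (`succ_le_complexity_of_two_pow_lt`). -/

namespace RankOneRecovery

/-! ### Interpolation error for smooth functions -/

/-- A smooth function with `n + 1` zeros in `[0,1]` has an `n`-th derivative with a zero there. -/
theorem exists_iteratedDeriv_eq_zero (n : ℕ) : ∀ (f : ℝ → ℝ), ContDiff ℝ n f →
    ∀ z : Fin (n + 1) → ℝ, StrictMono z → (∀ i, z i ∈ Icc (0 : ℝ) 1) → (∀ i, f (z i) = 0) →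
    ∃ ξ ∈ Icc (0 : ℝ) 1, iteratedDeriv n f ξ = 0 := by
  induction n with
  | zero => exact fun f _ z _ hz h0 => ⟨z 0, hz 0, by simpa using h0 0⟩
  | succ n ih =>
    intro f hf z hz hmem h0
    have hc : ∀ i : Fin (n + 1), ∃ c ∈ Ioo (z i.castSucc) (z i.succ), deriv f c = 0 := fun i =>
      exists_deriv_eq_zero (hz (Fin.castSucc_lt_succ (i := i))) hf.continuous.continuousOn
        (by rw [h0, h0])
    choose c hc hc0 using hc
    have hd : ContDiff ℝ n (deriv f) := by
      have : ContDiff ℝ ((n : WithTop ℕ∞) + 1) f := by exact_mod_cast hf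
      exact (contDiff_succ_iff_deriv.1 this).2.2
    obtain ⟨ξ, hξ, h⟩ := ih (deriv f) hd c
      (Fin.strictMono_iff_lt_succ.2 fun i => by
        have h1 := (hc i.castSucc).2
        have h2 := (hc i.succ).1
        rw [Fin.succ_castSucc] at h1
        exact h1.trans h2)
      (fun i => ⟨(hmem _).1.trans (hc i).1.le, (hc i).2.le.trans (hmem _).2⟩) hc0
    exact ⟨ξ, hξ, by rw [iteratedDeriv_succ']; exact h⟩

theorem iteratedDeriv_polynomial (P : Polynomial ℝ) (n : ℕ) :
    iteratedDeriv n (fun x => P.eval x) = fun x => (Polynomial.derivative^[n] P).eval x := by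
  induction n with
  | zero => simp
  | succ n ih =>
    rw [iteratedDeriv_succ, ih, Function.iterate_succ_apply']
    ext x
    exact Polynomial.deriv _

theorem eval_iterate_derivative_of_natDegree_le {P : Polynomial ℝ} {n : ℕ} (h : P.natDegree ≤ n)
    (x : ℝ) : (Polynomial.derivative^[n] P).eval x = n.factorial * P.coeff n := by
  have h0 : (Polynomial.derivative^[n] P).natDegree = 0 := by
    have := Polynomial.natDegree_iterate_derivative P n
    omega
  rw [Polynomial.eq_C_of_natDegree_eq_zero h0, Polynomial.coeff_iterate_derivative]
  simp [Nat.descFactorial_self]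

/-- The error of polynomial interpolation of a smooth function at `r` nodes. -/
theorem abs_sub_interpolate_le_of_contDiff {r : ℕ} {M : ℝ} {f : ℝ → ℝ} (hf : ContDiff ℝ r f)
    (hM : ∀ x ∈ Icc (0 : ℝ) 1, |iteratedDeriv r f x| ≤ M) (s : Finset ℝ) (hs : s.card = r)
    (hs1 : ∀ z ∈ s, z ∈ Icc (0 : ℝ) 1) {x : ℝ} (hx : x ∈ Icc (0 : ℝ) 1) :
    |f x - (Lagrange.interpolate s id f).eval x| ≤ M / r.factorial * ∏ z ∈ s, |x - z| := by
  classical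
  have hM0 : 0 ≤ M := (abs_nonneg _).trans (hM x hx)
  have hinj : Set.InjOn (id : ℝ → ℝ) s := Function.injective_id.injOn
  have hfac : (0 : ℝ) < r.factorial := by exact_mod_cast r.factorial_pos
  by_cases hxs : x ∈ s
  · have : (Lagrange.interpolate s id f).eval x = f x :=
      Lagrange.eval_interpolate_at_node (v := id) f hinj hxs
    rw [this, sub_self, abs_zero]
    positivity
  have hnod : (Lagrange.nodal s (id : ℝ → ℝ)).eval x ≠ 0 := by
    rw [Lagrange.eval_nodal, Finset.prod_ne_zero_iff]
    intro z hz h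
    exact hxs (by rw [sub_eq_zero.1 h]; exact hz)
  set P := Lagrange.interpolate s id f with hP
  -- This `K` makes `f - Q` vanish at `x` as well as at the `r` nodes, so Rolle gives `ξ` with
  -- `f⁽ʳ⁾(ξ) = r! K`.
  set K := (f x - P.eval x) / (Lagrange.nodal s (id : ℝ → ℝ)).eval x with hK
  set Q := P + Polynomial.C K * Lagrange.nodal s id with hQ
  have hPdeg : P.degree < r := by
    rw [← hs]; exact Lagrange.degree_interpolate_lt _ hinj
  have hnd : (Lagrange.nodal s (id : ℝ → ℝ)).natDegree = r := by
    rw [Lagrange.natDegree_nodal, hs]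
  have hQdeg : Q.natDegree ≤ r := by
    refine (Polynomial.natDegree_add_le _ _).trans (max_le ?_ ?_)
    · exact Polynomial.natDegree_le_iff_degree_le.2 hPdeg.le
    · exact (Polynomial.natDegree_C_mul_le _ _).trans hnd.le
  have hQc : Q.coeff r = K := by
    have h1 : (Lagrange.nodal s (id : ℝ → ℝ)).coeff r = 1 := by
      have := (Lagrange.nodal_monic (s := s) (v := (id : ℝ → ℝ))).coeff_natDegree
      rwa [hnd] at this
    rw [hQ, Polynomial.coeff_add, Polynomial.coeff_eq_zero_of_degree_lt hPdeg,
      Polynomial.coeff_C_mul, h1]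
    simp
  have hcard : (insert x s).card = r + 1 := by rw [Finset.card_insert_of_notMem hxs, hs]
  let z := (insert x s).orderEmbOfFin hcard
  have hzm : ∀ i, z i ∈ insert x s := fun i => Finset.orderEmbOfFin_mem _ _ _
  have hQs : ContDiff ℝ r fun t => Q.eval t := by
    simpa using Q.contDiff_aeval (𝕜 := ℝ) r
  obtain ⟨ξ, hξ, h0⟩ := exists_iteratedDeriv_eq_zero r (fun t => f t - Q.eval t)
    (hf.sub hQs) z z.strictMono (fun i => by
      rcases Finset.mem_insert.1 (hzm i) with h | h
      · rw [h]; exact hx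
      · exact hs1 _ h) (fun i => by
      rcases Finset.mem_insert.1 (hzm i) with h | h
      · rw [h, hQ, Polynomial.eval_add, Polynomial.eval_mul, Polynomial.eval_C, hK,
          div_mul_cancel₀ _ hnod]
        ring
      · rw [hQ, Polynomial.eval_add, Polynomial.eval_mul,
          Lagrange.eval_nodal (v := (id : ℝ → ℝ)), Finset.prod_eq_zero h (by simp),
          show P.eval (z i) = f (z i) from
            Lagrange.eval_interpolate_at_node (v := (id : ℝ → ℝ)) f hinj h]
        simp)
  rw [iteratedDeriv_fun_sub hf.contDiffAt hQs.contDiffAt, iteratedDeriv_polynomial] at h0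
  simp only [eval_iterate_derivative_of_natDegree_le hQdeg, hQc, sub_eq_zero] at h0
  have hKM : |K| ≤ M / r.factorial := by
    rw [le_div_iff₀ hfac]
    have := hM ξ hξ
    rw [h0, abs_mul, abs_of_pos hfac] at this
    linarith
  have : f x - P.eval x = K * (Lagrange.nodal s (id : ℝ → ℝ)).eval x := by
    rw [hK, div_mul_cancel₀ _ hnod]
  rw [this, abs_mul, Lagrange.eval_nodal, Finset.abs_prod]
  simp only [id]
  gcongr

/-! ### Mollification and interpolation in the Sobolev class -/

theorem iteratedDeriv_convolution_right {F ρ : ℝ → ℝ} (hF : Continuous F)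
    (hρ : ContDiff ℝ ((⊤ : ℕ∞) : WithTop ℕ∞) ρ) (hc : HasCompactSupport ρ) (k : ℕ) :
    HasCompactSupport (iteratedDeriv k ρ) ∧
    iteratedDeriv k (convolution F ρ (ContinuousLinearMap.mul ℝ ℝ) volume) =
      convolution F (iteratedDeriv k ρ) (ContinuousLinearMap.mul ℝ ℝ) volume := by
  induction k with
  | zero => simp [hc]
  | succ k ih =>
    have hk : ContDiff ℝ 1 (iteratedDeriv k ρ) :=
      ContDiff.iterate_deriv' 1 k (hρ.of_le (by exact_mod_cast le_top)) |> fun h => by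
        rw [iteratedDeriv_eq_iterate]; exact h
    refine ⟨by rw [iteratedDeriv_succ]; exact ih.1.deriv, ?_⟩
    rw [iteratedDeriv_succ, ih.2, iteratedDeriv_succ]
    ext x
    exact (ih.1.hasDerivAt_convolution_right _ hF.locallyIntegrable hk x).deriv

theorem support_iteratedDeriv_subset_tsupport (ρ : ℝ → ℝ) (k : ℕ) :
    Function.support (iteratedDeriv k ρ) ⊆ tsupport ρ := by
  have : tsupport (iteratedDeriv k ρ) ⊆ tsupport ρ := by
    induction k with
    | zero => simp
    | succ k ih => rw [iteratedDeriv_succ]; exact (tsupport_deriv_subset).trans ih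
  exact (subset_tsupport _).trans this

/-- Mollifications inherit the bound on the weak derivative. -/
theorem abs_iteratedDeriv_convolution_le {r : ℕ} {M : ℝ} (hM : 0 ≤ M) {f g F : ℝ → ℝ}
    (hfg : HasWeakDeriv r f g)
    (hg : eLpNorm g ⊤ (volume.restrict (Ioo (0 : ℝ) 1)) ≤ ENNReal.ofReal M)
    (hF : Continuous F) (hFf : ∀ x ∈ Icc (0 : ℝ) 1, F x = f x) (φ : ContDiffBump (0 : ℝ))
    {x : ℝ} (hx : φ.rOut < x) (hx1 : x < 1 - φ.rOut) :
    |iteratedDeriv r (convolution F (φ.normed volume) (ContinuousLinearMap.mul ℝ ℝ) volume) x|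
      ≤ M := by
  set ρ := φ.normed volume with hρdef
  have hρ : ContDiff ℝ ((⊤ : ℕ∞) : WithTop ℕ∞) ρ := φ.contDiff_normed
  have hρc : HasCompactSupport ρ := φ.hasCompactSupport_normed
  have hts : tsupport ρ = Metric.closedBall 0 φ.rOut := φ.tsupport_normed_eq
  -- The reflected bump is supported inside `(0,1)`, so it is an admissible test function. The sign
  -- from differentiating the reflection cancels the one in the definition of the weak derivative.
  let ψ : ℝ → ℝ := fun y => ρ (x - y)
  have hψs : ContDiff ℝ ((⊤ : ℕ∞) : WithTop ℕ∞) ψ := hρ.comp (contDiff_const.sub contDiff_id)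
  have hψsub : tsupport ψ ⊆ Metric.closedBall x φ.rOut := by
    refine closure_minimal ?_ Metric.isClosed_closedBall
    intro y hy
    have : x - y ∈ tsupport ρ := subset_tsupport _ hy
    rw [hts] at this
    rw [Metric.mem_closedBall, dist_comm, Real.dist_eq]
    simpa using this
  have hball : Metric.closedBall x φ.rOut ⊆ Ioo 0 1 := by
    rw [Real.closedBall_eq_Icc]
    exact fun y hy => ⟨by linarith [hy.1], by linarith [hy.2]⟩
  have hψc : HasCompactSupport ψ :=
    (isCompact_closedBall x φ.rOut).of_isClosed_subset (isClosed_tsupport _) hψsub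
  have hweak := hfg.2.2 ψ hψs hψc (hψsub.trans hball)
  have hder : iteratedDeriv r ψ = fun y => (-1 : ℝ) ^ r • iteratedDeriv r ρ (x - y) :=
    iteratedDeriv_comp_const_sub r ρ x
  have hconv : iteratedDeriv r (convolution F ρ (ContinuousLinearMap.mul ℝ ℝ) volume) x
      = ∫ y in Ioo (0 : ℝ) 1, g y * ψ y := by
    rw [(iteratedDeriv_convolution_right hF hρ hρc r).2, convolution_def]
    have h1 : ∫ t, (ContinuousLinearMap.mul ℝ ℝ) (F t) (iteratedDeriv r ρ (x - t))
        = ∫ t in Ioo (0 : ℝ) 1, (-1) ^ r * (f t * iteratedDeriv r ψ t) := by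
      rw [← setIntegral_eq_integral_of_forall_compl_eq_zero (s := Ioo (0 : ℝ) 1)]
      · refine setIntegral_congr_fun measurableSet_Ioo fun t ht => ?_
        simp only [ContinuousLinearMap.mul_apply', hder, smul_eq_mul]
        rw [hFf t ⟨ht.1.le, ht.2.le⟩]
        have : ((-1 : ℝ) ^ r) * (-1) ^ r = 1 := by rw [← mul_pow]; norm_num
        linear_combination (-(f t * iteratedDeriv r ρ (x - t))) * this
      · intro t ht
        have : iteratedDeriv r ρ (x - t) = 0 := by
          by_contra h
          have h2 : x - t ∈ tsupport ρ := support_iteratedDeriv_subset_tsupport ρ r h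
          rw [hts] at h2
          refine ht (hball ?_)
          rw [Metric.mem_closedBall, dist_comm, Real.dist_eq]
          simpa using h2
        simp [this]
    rw [h1, integral_const_mul, hweak, ← mul_assoc, ← mul_pow]
    simp
  rw [hconv]
  have hae : ∀ᵐ y ∂(volume.restrict (Ioo (0 : ℝ) 1)), ‖g y * ψ y‖ ≤ M * ψ y := by
    have := ae_le_eLpNormEssSup (f := g) (μ := volume.restrict (Ioo (0 : ℝ) 1))
    filter_upwards [this] with y hy
    have h2 : ‖g y‖ₑ ≤ ENNReal.ofReal M := hy.trans (by simpa using hg)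
    have h3 : ‖g y‖ ≤ M := by
      rw [← ofReal_norm] at h2
      exact (ENNReal.ofReal_le_ofReal_iff hM).1 h2
    have h4 : 0 ≤ ψ y := φ.nonneg_normed _
    rw [norm_mul, Real.norm_of_nonneg h4]
    gcongr
  have hint : Integrable ψ := hψs.continuous.integrable_of_hasCompactSupport hψc
  have h5 := norm_integral_le_of_norm_le ((hint.const_mul M).integrableOn (s := Ioo 0 1)) hae
  rw [Real.norm_eq_abs] at h5
  refine h5.trans ?_
  rw [integral_const_mul]
  have h6 : ∫ y in Ioo (0 : ℝ) 1, ψ y ≤ 1 := by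
    calc ∫ y in Ioo (0 : ℝ) 1, ψ y ≤ ∫ y, ψ y :=
          setIntegral_le_integral hint (Filter.Eventually.of_forall fun y => φ.nonneg_normed _)
      _ = ∫ y, ρ y := integral_sub_left_eq_self ρ volume x
      _ = 1 := φ.integral_normed
  nlinarith

/-- Functions of the class are uniform limits on `[0,1]` of smooth functions satisfying the same
bound on the `r`-th derivative. -/
theorem exists_contDiff_approx {r : ℕ} {M : ℝ} (hM : 0 ≤ M) {f : ℝ → ℝ}
    (hf : f ∈ factorClass r M) {η : ℝ} (hη : 0 < η) :
    ∃ h : ℝ → ℝ, ContDiff ℝ r h ∧ (∀ x ∈ Icc (0 : ℝ) 1, |iteratedDeriv r h x| ≤ M) ∧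
      ∀ x ∈ Icc (0 : ℝ) 1, |h x - f x| ≤ η := by
  obtain ⟨hs, -, g, hfg, hg⟩ := hf
  -- Extension by the constant boundary values keeps uniform continuity on the whole line.
  set F : ℝ → ℝ := IccExtend zero_le_one ((Icc (0 : ℝ) 1).domRestrict f) with hFdef
  have hFu : UniformContinuous F := by
    have h1 : UniformContinuous ((Icc (0 : ℝ) 1).domRestrict f) :=
      CompactSpace.uniformContinuous_of_continuous hs.1.domRestrict
    exact h1.comp (LipschitzWith.projIcc (zero_le_one)).uniformContinuous
  have hFf : ∀ x ∈ Icc (0 : ℝ) 1, F x = f x := fun x hx => by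
    rw [hFdef, IccExtend_of_mem _ _ hx]; rfl
  obtain ⟨δ₀, hδ₀, hu⟩ := Metric.uniformContinuous_iff.1 hFu (η / 2) (half_pos hη)
  set δ := min (δ₀ / 4) (1 / 8) with hδdef
  have hδ : 0 < δ := lt_min (by positivity) (by norm_num)
  have hδ1 : δ ≤ δ₀ / 4 := min_le_left _ _
  have hδ2 : δ ≤ 1 / 8 := min_le_right _ _
  let φ : ContDiffBump (0 : ℝ) := ⟨δ / 2, δ, by positivity, by linarith⟩
  set c := convolution F (φ.normed volume) (ContinuousLinearMap.mul ℝ ℝ) volume with hc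
  have hcs : ContDiff ℝ r c := by
    have : ContDiff ℝ ((r : ℕ∞) : WithTop ℕ∞) c :=
      φ.hasCompactSupport_normed.contDiff_convolution_right _ hFu.continuous.locallyIntegrable
        φ.contDiff_normed
    exact_mod_cast this
  have hcF : ∀ x, |c x - F x| ≤ η / 2 := by
    intro x
    have h1 := φ.dist_normed_convolution_le (μ := volume) (g := F) (x₀ := x) (ε := η / 2)
      hFu.continuous.aestronglyMeasurable (fun y hy => by
        refine (hu (lt_trans (Metric.mem_ball.1 hy) ?_)).le
        show δ < δ₀
        linarith)
    rw [Real.dist_eq] at h1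
    have h2 : convolution (φ.normed volume) F (ContinuousLinearMap.lsmul ℝ ℝ) volume x = c x := by
      rw [hc, convolution_def, convolution_eq_swap]
      refine integral_congr_ae (Filter.Eventually.of_forall fun t => ?_)
      simp [mul_comm]
    rwa [h2] at h1
  -- The affine map sends `[0,1]` to `[2δ, 1 - 2δ]`, where mollification at radius `δ` sees only
  -- `(0,1)`. It contracts, so the bound on the `r`-th derivative survives, and it moves points by
  -- at most `2δ`.
  have hT : ContDiff ℝ r fun x => c ((1 - 4 * δ) * x + 2 * δ) :=
    hcs.comp ((contDiff_const.mul contDiff_id).add contDiff_const)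
  refine ⟨fun x => c ((1 - 4 * δ) * x + 2 * δ), hT, fun x hx => ?_, fun x hx => ?_⟩
  · have h1 : iteratedDeriv r (fun x => c ((1 - 4 * δ) * x + 2 * δ)) x
        = (1 - 4 * δ) ^ r * iteratedDeriv r c ((1 - 4 * δ) * x + 2 * δ) := by
      have h2 := iteratedDeriv_comp_const_mul (n := r) (f := fun y => c (y + 2 * δ))
        (hcs.comp (contDiff_id.add contDiff_const)) (1 - 4 * δ)
      have h3 := iteratedDeriv_comp_add_const r c (2 * δ)
      rw [h3] at h2
      exact congrFun h2 x
    rw [h1, abs_mul, abs_pow, abs_of_nonneg (by linarith : 0 ≤ 1 - 4 * δ)]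
    have h4 : (1 - 4 * δ) ^ r ≤ 1 := pow_le_one₀ (by linarith) (by linarith)
    have h5 : |iteratedDeriv r c ((1 - 4 * δ) * x + 2 * δ)| ≤ M := by
      refine abs_iteratedDeriv_convolution_le hM hfg hg hFu.continuous hFf φ ?_ ?_
      · show δ < _
        nlinarith [hx.1, hx.2]
      · show _ < 1 - δ
        nlinarith [hx.1, hx.2]
    have h6 : 0 ≤ (1 - 4 * δ) ^ r := pow_nonneg (by linarith) _
    nlinarith [abs_nonneg (iteratedDeriv r c ((1 - 4 * δ) * x + 2 * δ))]
  · have h1 := hcF ((1 - 4 * δ) * x + 2 * δ)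
    have h2 : dist (F ((1 - 4 * δ) * x + 2 * δ)) (F x) < η / 2 := by
      refine hu ?_
      rw [Real.dist_eq, abs_lt]
      constructor <;> nlinarith [hx.1, hx.2]
    rw [Real.dist_eq, hFf x hx] at h2
    have h3 := abs_sub_le (c ((1 - 4 * δ) * x + 2 * δ)) (F ((1 - 4 * δ) * x + 2 * δ)) (f x)
    show |c ((1 - 4 * δ) * x + 2 * δ) - f x| ≤ η
    linarith

/-- The error of polynomial interpolation at `r` nodes in the class. -/
theorem abs_sub_sum_basis_le {r : ℕ} {M : ℝ} (hM : 0 ≤ M) {f : ℝ → ℝ}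
    (hf : f ∈ factorClass r M) (s : Finset ℝ) (hs : s.card = r)
    (hs1 : ∀ z ∈ s, z ∈ Icc (0 : ℝ) 1) {x : ℝ} (hx : x ∈ Icc (0 : ℝ) 1) :
    |f x - ∑ z ∈ s, f z * (Lagrange.basis s id z).eval x|
      ≤ M / r.factorial * ∏ z ∈ s, |x - z| := by
  set ℓ : ℝ → ℝ := fun z => (Lagrange.basis s id z).eval x with hℓ
  have hS : 0 ≤ ∑ z ∈ s, |ℓ z| := Finset.sum_nonneg fun _ _ => abs_nonneg _
  refine le_of_forall_pos_le_add fun ε hε => ?_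
  -- Both the value at `x` and the nodal values are perturbed, at a total cost of `η (1 + ∑ |ℓ z|) =
  -- ε`.
  obtain ⟨h, hh, hhM, hhf⟩ := exists_contDiff_approx hM hf
    (η := ε / (1 + ∑ z ∈ s, |ℓ z|)) (by positivity)
  set η := ε / (1 + ∑ z ∈ s, |ℓ z|) with hη
  have h1 := abs_sub_interpolate_le_of_contDiff hh hhM s hs hs1 hx
  rw [Lagrange.interpolate_apply, Polynomial.eval_finsetSum] at h1
  simp only [Polynomial.eval_mul, Polynomial.eval_C] at h1
  have h2 : |∑ z ∈ s, (h z - f z) * ℓ z| ≤ ∑ z ∈ s, η * |ℓ z| :=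
    (Finset.abs_sum_le_sum_abs _ _).trans (Finset.sum_le_sum fun z hz => by
      rw [abs_mul]
      exact mul_le_mul_of_nonneg_right (hhf z (hs1 z hz)) (abs_nonneg _))
  rw [← Finset.mul_sum] at h2
  have h3 : η + η * ∑ z ∈ s, |ℓ z| = ε := by
    rw [hη]; field_simp
  have h4 : f x - ∑ z ∈ s, f z * ℓ z
      = (h x - ∑ z ∈ s, h z * ℓ z) + (∑ z ∈ s, (h z - f z) * ℓ z - (h x - f x)) := by
    simp only [sub_mul, Finset.sum_sub_distrib]
    ring
  have h5 := hhf x hx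
  calc |f x - ∑ z ∈ s, f z * ℓ z|
      ≤ |h x - ∑ z ∈ s, h z * ℓ z| + |∑ z ∈ s, (h z - f z) * ℓ z - (h x - f x)| := by
        rw [h4]; exact abs_add_le _ _
    _ ≤ |h x - ∑ z ∈ s, h z * ℓ z| + (|∑ z ∈ s, (h z - f z) * ℓ z| + |h x - f x|) := by
        gcongr; exact abs_sub _ _
    _ ≤ _ := by
        have : |h x - ∑ z ∈ s, h z * ℓ z| ≤ M / r.factorial * ∏ z ∈ s, |x - z| := h1
        linarith

/-! ### Recovery from a grid and zeros on a grid -/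

/-- The equidistant grid points `j / m`, `0 ≤ j < m`. -/
noncomputable def gridPoint (m : ℕ) (j : Fin m) : unitInterval :=
  ⟨(j : ℝ) / m, by positivity, by
    have h : (j : ℝ) ≤ m := by exact_mod_cast j.2.le
    exact div_le_one_of_le₀ h (by positivity)⟩

theorem coe_gridPoint {m : ℕ} (j : Fin m) : (gridPoint m j : ℝ) = (j : ℝ) / m := rfl

theorem gridPoint_injective (m : ℕ) : Function.Injective fun j => (gridPoint m j : ℝ) := by
  intro i j h
  have hm : (m : ℝ) ≠ 0 := by
    have := i.pos
    positivity
  simp only [coe_gridPoint] at h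
  rw [div_left_inj' hm] at h
  exact Fin.ext (by exact_mod_cast h)

/-- Values of functions of the class can be approximated linearly from values on the grid. -/
theorem exists_grid_weights {r m : ℕ} (hr : 1 ≤ r) (hrm : r ≤ m) {x : ℝ}
    (hx : x ∈ Icc (0 : ℝ) 1) :
    ∃ c : Fin m → ℝ, ∀ M : ℝ, 0 ≤ M → ∀ f ∈ factorClass r M,
      |f x - ∑ j, f (gridPoint m j) * c j| ≤ M / r.factorial * ((r : ℝ) / m) ^ r := by
  classical
  have hm : (0 : ℝ) < m := by exact_mod_cast (by omega : 0 < m)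
  set q := ⌊x * m⌋₊ with hq
  have hxm : 0 ≤ x * m := mul_nonneg hx.1 hm.le
  have hxm1 : x * m ≤ m := by nlinarith [hx.2]
  have hq1 : (q : ℝ) ≤ x * m := Nat.floor_le hxm
  have hq2 : x * m < q + 1 := Nat.lt_floor_add_one _
  -- A window of `r` consecutive grid points starts just left of `x`, or is pushed back to the last
  -- `r` points when `x` is near 1.
  set j₀ := min q (m - r) with hj₀
  have hj1 : j₀ + r ≤ m := by omega
  let e : Fin r → Fin m := fun i => ⟨j₀ + i, by omega⟩
  have he : Function.Injective e := fun i k h => Fin.ext (by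
    have := congrArg Fin.val h
    simp only [e] at this
    omega)
  let t : Fin r → ℝ := fun i => gridPoint m (e i)
  have ht : Function.Injective t := (gridPoint_injective m).comp he
  let s : Finset ℝ := Finset.univ.image t
  let ℓ : ℝ → ℝ := fun z => (Lagrange.basis s id z).eval x
  have hclose : ∀ i, |x - t i| ≤ (r : ℝ) / m := by
    intro i
    have h1 : t i = ((j₀ + i : ℕ) : ℝ) / m := rfl
    have h2 : x - t i = (x * m - ((j₀ + i : ℕ) : ℝ)) / m := by
      rw [h1, sub_div, mul_div_cancel_right₀ _ hm.ne']
    rw [h2, abs_div, abs_of_pos hm]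
    gcongr
    have hi : ((i : ℕ) : ℝ) + 1 ≤ r := by exact_mod_cast i.2
    have hi0 : (0 : ℝ) ≤ ((i : ℕ) : ℝ) := by positivity
    push_cast
    rcases le_total q (m - r) with h | h
    · have : j₀ = q := min_eq_left h
      rw [this, abs_le]
      constructor <;> linarith
    · have h3 : j₀ = m - r := min_eq_right h
      have h4 : (j₀ : ℝ) = m - r := by rw [h3, Nat.cast_sub hrm]
      have h5 : (j₀ : ℝ) ≤ q := by exact_mod_cast h3 ▸ h
      rw [abs_le]
      constructor <;> linarith
  -- Lagrange basis values on the window, zero elsewhere. They depend on `x` only, so different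
  -- functions can share them.
  refine ⟨fun j => ∑ i, if e i = j then ℓ (t i) else 0, fun M hM f hf => ?_⟩
  have hsum : ∑ j, f (gridPoint m j) * (∑ i, if e i = j then ℓ (t i) else 0)
      = ∑ z ∈ s, f z * ℓ z := by
    rw [Finset.sum_image (fun a _ b _ h => ht h)]
    simp_rw [Finset.mul_sum]
    rw [Finset.sum_comm]
    refine Finset.sum_congr rfl fun i _ => ?_
    simp [t]
  rw [hsum]
  refine (abs_sub_sum_basis_le hM hf s ?_ ?_ hx).trans ?_
  · rw [Finset.card_image_of_injective _ ht, Finset.card_univ, Fintype.card_fin]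
  · intro z hz
    obtain ⟨i, -, rfl⟩ := Finset.mem_image.1 hz
    exact (gridPoint m (e i)).2
  · rw [Finset.prod_image (fun a _ b _ h => ht h)]
    gcongr
    calc ∏ i, |x - t i| ≤ ∏ _i : Fin r, (r : ℝ) / m :=
          Finset.prod_le_prod (fun _ _ => abs_nonneg _) fun i _ => hclose i
      _ = _ := by rw [Finset.prod_const, Finset.card_univ, Fintype.card_fin]

/-- Near a point where it is large, a function of the class has fewer than `r` zeros. -/
theorem card_zeros_lt {r m : ℕ} (hr : 1 ≤ r) {M : ℝ} (hM : 0 < M) {f : ℝ → ℝ}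
    (hf : f ∈ factorClass r M) {x ρ : ℝ} (hx : x ∈ Icc (0 : ℝ) 1) (hρ : 0 < ρ)
    (hfx : M / r.factorial * ρ ^ r ≤ |f x|) (Z : Finset (Fin m))
    (hZ : ∀ j ∈ Z, |x - gridPoint m j| < ρ ∧ f (gridPoint m j) = 0) : Z.card < r := by
  by_contra! h
  obtain ⟨Y, hYZ, hY⟩ := Finset.exists_subset_card_eq h
  have hfac : (0 : ℝ) < r.factorial := by exact_mod_cast r.factorial_pos
  have hpos : 0 < |f x| := lt_of_lt_of_le (by positivity) hfx
  have hinj := gridPoint_injective m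
  -- With `r` zeros as nodes the interpolant is zero, and the error bound becomes a bound for `|f
  -- x|` itself.
  have h1 := abs_sub_sum_basis_le hM.le hf (Y.map ⟨_, hinj⟩) (by rw [Finset.card_map, hY])
    (fun z hz => by
      obtain ⟨j, -, rfl⟩ := Finset.mem_map.1 hz
      exact (gridPoint m j).2) hx
  rw [Finset.sum_eq_zero, sub_zero, Finset.prod_map] at h1
  · have h2 : ∏ j ∈ Y, |x - gridPoint m j| < ∏ _j ∈ Y, ρ := by
      refine Finset.prod_lt_prod_of_nonempty (fun j hj => ?_) (fun j hj => (hZ j (hYZ hj)).1) ?_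
      · rw [abs_pos, sub_ne_zero]
        intro h3
        have h4 := (hZ j (hYZ hj)).2
        rw [← h3] at h4
        simp [h4] at hpos
      · rw [← Finset.card_pos]; omega
    rw [Finset.prod_const, hY] at h2
    have h3 : M / r.factorial * ∏ j ∈ Y, |x - gridPoint m j| < M / r.factorial * ρ ^ r := by
      gcongr
    exact absurd (h1.trans_lt h3) (not_lt.2 hfx)
  · intro z hz
    obtain ⟨j, hj, rfl⟩ := Finset.mem_map.1 hz
    simp [(hZ j (hYZ hj)).2]

/-- The indices of the grid points in the open interval `(a, b)`. -/
noncomputable def gridIn (m : ℕ) (a b : ℝ) : Finset (Fin m) :=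
  Finset.univ.filter fun j => (gridPoint m j : ℝ) ∈ Ioo a b

/-- The integers strictly between `a m` and `b m` are counted; rounding at the ends costs at most
one. -/
theorem le_card_gridIn {m : ℕ} (hm : 0 < m) {a b : ℝ} (ha : 0 ≤ a) (hb : b ≤ 1) :
    (b - a) * m - 1 ≤ (gridIn m a b).card := by
  have hm' : (0 : ℝ) < m := by exact_mod_cast hm
  have hsub : Finset.Ico (⌊a * m⌋₊ + 1) ⌈b * m⌉₊ ⊆ (gridIn m a b).map Fin.valEmbedding := by
    intro j hj
    rw [Finset.mem_Ico] at hj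
    have h1 : a * m < j := by
      have : (⌊a * m⌋₊ : ℝ) + 1 ≤ j := by exact_mod_cast hj.1
      linarith [Nat.lt_floor_add_one (a * m)]
    have h2 : (j : ℝ) < b * m := Nat.lt_ceil.1 hj.2
    have h3 : j < m := by
      have : (j : ℝ) < m := by nlinarith
      exact_mod_cast this
    rw [Finset.mem_map]
    refine ⟨⟨j, h3⟩, Finset.mem_filter.2 ⟨Finset.mem_univ _, ?_⟩, rfl⟩
    rw [coe_gridPoint]
    exact ⟨by rw [lt_div_iff₀ hm']; exact h1, by rw [div_lt_iff₀ hm']; exact h2⟩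
  have h := Finset.card_le_card hsub
  rw [Finset.card_map, Nat.card_Ico] at h
  have h1 : ((⌈b * m⌉₊ : ℝ)) ≤ (gridIn m a b).card + (⌊a * m⌋₊ + 1) := by
    exact_mod_cast (by omega : ⌈b * m⌉₊ ≤ (gridIn m a b).card + (⌊a * m⌋₊ + 1))
  have h2 := Nat.le_ceil (b * m)
  have h3 := Nat.floor_le (mul_nonneg ha hm'.le)
  linarith

open Classical in
/-- The indices of the grid points where `f` does not vanish. -/
noncomputable def gridSupport (m : ℕ) (f : ℝ → ℝ) : Finset (Fin m) :=
  Finset.univ.filter fun j => f (gridPoint m j) ≠ 0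

/-- All grid points of the interval lie within `ρ` of `x`, so at most `r - 1` of them are zeros. -/
theorem card_gridIn_le {r m : ℕ} (hr : 1 ≤ r) {M : ℝ} (hM : 0 < M) {f : ℝ → ℝ}
    (hf : f ∈ factorClass r M) {x ρ a b : ℝ} (hx : x ∈ Icc (0 : ℝ) 1) (hρ : 0 < ρ)
    (hfx : M / r.factorial * ρ ^ r ≤ |f x|) (hab : ∀ y ∈ Ioo a b, |x - y| < ρ) :
    ((gridIn m a b).card : ℝ) + 1 ≤ (gridIn m a b ∩ gridSupport m f).card + r := by
  classical
  have h1 := card_zeros_lt (m := m) hr hM hf hx hρ hfx (gridIn m a b \ gridSupport m f)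
    (fun j hj => by
      simp only [gridIn, gridSupport, Finset.mem_sdiff, Finset.mem_filter, Finset.mem_univ,
        true_and, not_not] at hj
      exact ⟨hab _ hj.1, hj.2⟩)
  have h2 := Finset.card_inter_add_card_sdiff (gridIn m a b) (gridSupport m f)
  exact_mod_cast (by omega :
    (gridIn m a b).card + 1 ≤ (gridIn m a b ∩ gridSupport m f).card + r)

/-- At worst `x` is an endpoint, and since `ρ ≤ 1` the part of `(x - ρ, x + ρ)` in `[0,1]` still has
length at least `ρ`. One point is lost by rounding and `r - 1` to zeros. -/
theorem le_card_gridSupport {r m : ℕ} (hr : 1 ≤ r) (hm : 0 < m) {M : ℝ} (hM : 0 < M) {f : ℝ → ℝ}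
    (hf : f ∈ factorClass r M) {x ρ : ℝ} (hx : x ∈ Icc (0 : ℝ) 1) (hρ : 0 < ρ) (hρ1 : ρ ≤ 1)
    (hfx : M / r.factorial * ρ ^ r ≤ |f x|) :
    ρ * m - r ≤ (gridSupport m f).card := by
  have hm' : (0 : ℝ) < m := by exact_mod_cast hm
  have h1 := card_gridIn_le (m := m) (a := max (x - ρ) 0) (b := min (x + ρ) 1) hr hM hf hx hρ hfx
    (fun y hy => by
      have h2 := (le_max_left _ _).trans_lt hy.1
      have h3 := hy.2.trans_le (min_le_left _ _)
      rw [abs_lt]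
      constructor <;> linarith)
  have h2 := le_card_gridIn hm (a := max (x - ρ) 0) (b := min (x + ρ) 1) (le_max_right _ _)
    (min_le_right _ _)
  have h3 : ((gridIn m (max (x - ρ) 0) (min (x + ρ) 1) ∩ gridSupport m f).card : ℝ)
      ≤ (gridSupport m f).card := by
    exact_mod_cast Finset.card_le_card Finset.inter_subset_right
  have h4 : ρ ≤ min (x + ρ) 1 - max (x - ρ) 0 := by
    rcases max_cases (x - ρ) 0 with ⟨h, _⟩ | ⟨h, _⟩ <;>
    rcases min_cases (x + ρ) 1 with ⟨h', _⟩ | ⟨h', _⟩ <;>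
    rw [h, h'] <;> linarith [hx.1, hx.2]
  nlinarith

/-! ### Detecting tensors that are not small -/

/-- Greedy choice of points hitting sets of weight at least `v`. -/
theorem exists_card_unhit_le {X ι : Type*} [Fintype X] [DecidableEq X] {w : X → ℝ}
    (hw : ∀ x, 0 ≤ w x) (hw1 : ∑ x, w x = 1) (S : ι → Finset X) (B : Finset ι) {v : ℝ}
    (hv : ∀ i ∈ B, v ≤ ∑ x ∈ S i, w x) (hv1 : v ≤ 1) (N : ℕ) :
    ∃ P : Fin N → X,
      ((B.filter fun i => ∀ k, P k ∉ S i).card : ℝ) ≤ (1 - v) ^ N * B.card := by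
  induction N with
  | zero => exact ⟨Fin.elim0, by simp⟩
  | succ N ih =>
    obtain ⟨P, hP⟩ := ih
    set C := B.filter fun i => ∀ k, P k ∉ S i with hC
    -- Each remaining set is missed with weight at most `1 - v`, so the `w`-average of the number of
    -- missed sets is at most `(1 - v) |C|`.
    obtain ⟨x, hx⟩ : ∃ x, ((C.filter fun i => x ∉ S i).card : ℝ) ≤ (1 - v) * C.card := by
      by_contra! h
      have h1 : ∑ x, w x * ((1 - v) * C.card)
          < ∑ x, w x * ((C.filter fun i => x ∉ S i).card : ℝ) := by
        refine Finset.sum_lt_sum (fun x _ => mul_le_mul_of_nonneg_left (h x).le (hw x)) ?_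
        obtain ⟨x, -, hx⟩ := Finset.exists_ne_zero_of_sum_ne_zero
          (by rw [hw1]; exact one_ne_zero : ∑ x, w x ≠ 0)
        exact ⟨x, Finset.mem_univ _,
          mul_lt_mul_of_pos_left (h x) (lt_of_le_of_ne (hw x) (Ne.symm hx))⟩
      rw [← Finset.sum_mul, hw1, one_mul] at h1
      have h2 : ∑ x, w x * ((C.filter fun i => x ∉ S i).card : ℝ)
          = ∑ i ∈ C, ∑ x, if x ∉ S i then w x else 0 := by
        rw [Finset.sum_comm]
        refine Finset.sum_congr rfl fun x _ => ?_
        rw [← Finset.sum_filter, Finset.sum_const, nsmul_eq_mul, mul_comm]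
      have h3 : ∀ i ∈ C, (∑ x, if x ∉ S i then w x else 0) ≤ 1 - v := by
        intro i hi
        have h4 := hv i (Finset.filter_subset _ _ hi)
        have h5 : (∑ x, if x ∉ S i then w x else 0) + ∑ x ∈ S i, w x = 1 := by
          rw [← hw1, ← Finset.sum_filter, add_comm]
          rw [← Finset.sum_filter_add_sum_filter_not Finset.univ (fun x => x ∈ S i)]
          simp
        linarith
      have h6 := Finset.sum_le_sum h3
      rw [Finset.sum_const, nsmul_eq_mul] at h6
      rw [h2] at h1
      linarith
    refine ⟨Fin.cons x P, ?_⟩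
    have h1 : (B.filter fun i => ∀ k, (Fin.cons x P : Fin (N + 1) → X) k ∉ S i)
        = C.filter fun i => x ∉ S i := by
      ext i
      simp only [hC, Finset.mem_filter, Fin.forall_fin_succ, Fin.cons_zero, Fin.cons_succ]
      tauto
    rw [h1, pow_succ']
    refine hx.trans ?_
    rw [mul_assoc]
    exact mul_le_mul_of_nonneg_left hP (by linarith)

theorem continuous_of_mem_tensorClass {r : ℕ} {M : ℝ} {d : ℕ} {f : Cube d → ℝ}
    (hf : f ∈ tensorClass r M d) : Continuous f := by
  obtain ⟨F, hF, rfl⟩ := hf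
  refine continuous_finsetProd _ fun i _ => ?_
  have h1 : Continuous fun y : unitInterval => F i y :=
    continuousOn_iff_continuous_domRestrict.1 (hF i).1.1
  exact h1.comp (continuous_apply i)

theorem Algorithm.values_apply {d n : ℕ} (A : Algorithm d n) (f : Cube d → ℝ) (k : ℕ)
    (i : Fin k) : A.values f k i = f (A.node i (A.values f i)) := by
  induction k with
  | zero => exact i.elim0
  | succ k ih =>
    induction i using Fin.lastCases with
    | last => simp [Algorithm.values]
    | cast i => simpa [Algorithm.values] using ih i

theorem complexity_le_of_minimalError_le {r : ℕ} {M ε : ℝ} {n d : ℕ}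
    (h : minimalError r M n d ≤ ENNReal.ofReal ε) : complexity r M ε d ≤ n :=
  iInf₂_le n h

/-- If the values at `n` points determine the elements of the class up to `ε`, then `n` function
values suffice. -/
theorem complexity_le_of_determined {r : ℕ} {M ε : ℝ} {n d : ℕ} (Q : Fin n → Cube d)
    (hQ : ∀ f ∈ tensorClass r M d, ∀ g ∈ tensorClass r M d, (∀ k, f (Q k) = g (Q k)) →
      ∀ x, |f x - g x| ≤ ε) : complexity r M ε d ≤ n := by
  classical
  have hmem : ∀ f ∈ tensorClass r M d, MemLp f ⊤ (volume : Measure (Cube d)) := by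
    intro f hf
    have hc := continuous_of_mem_tensorClass hf
    obtain ⟨C, hC⟩ := isCompact_univ.exists_bound_of_continuousOn hc.continuousOn
    exact memLp_top_of_bound hc.aestronglyMeasurable C
      (Filter.Eventually.of_forall fun x => hC x (mem_univ x))
  let p : (Fin n → ℝ) → Prop := fun y => ∃ g ∈ tensorClass r M d, ∀ k, g (Q k) = y k
  -- The nodes are nonadaptive, and the output is any member of the class that fits the data. The
  -- default node and the default output are never met for inputs of the class.
  let A : Algorithm d n :=
    { node := fun k _ => if h : k < n then Q ⟨k, h⟩ else fun _ => 0
      output := fun y => if h : p y then (hmem h.choose h.choose_spec.1).toLp else 0 }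
  have hval : ∀ f k, A.values f n k = f (Q k) := by
    intro f k
    rw [Algorithm.values_apply]
    simp [A]
  refine complexity_le_of_minimalError_le ?_
  refine iInf_le_of_le n (iInf_le_of_le le_rfl (iInf_le_of_le A ?_))
  refine iSup₂_le fun f hf => ?_
  have hp : p (A.values f n) := ⟨f, hf, fun k => (hval f k).symm⟩
  have hrun : A.run f = (hmem hp.choose hp.choose_spec.1).toLp := by
    show (if h : p (A.values f n) then (hmem h.choose h.choose_spec.1).toLp else 0) = _
    rw [dif_pos hp]
  rw [hrun, eLpNorm_exponent_top]
  refine eLpNormEssSup_le_of_ae_bound ?_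
  filter_upwards [(hmem hp.choose hp.choose_spec.1).coeFn_toLp] with x hx
  rw [hx, Real.norm_eq_abs]
  exact hQ f hf _ hp.choose_spec.1 (fun k => by rw [hp.choose_spec.2 k, hval]) x

theorem abs_le_one_of_mem_factorClass {r : ℕ} {M : ℝ} {f : ℝ → ℝ} (hf : f ∈ factorClass r M)
    {x : ℝ} (hx : x ∈ Icc (0 : ℝ) 1) : |f x| ≤ 1 :=
  abs_le.2 (hf.2.1 x hx)

/-- By Bernoulli's inequality, a loss of `1 - 1/(2d)` in each coordinate costs only a factor 2
overall. -/
theorem half_le_one_sub_pow {d : ℕ} (hd : 1 ≤ d) : (1 / 2 : ℝ) ≤ (1 - 1 / (2 * d)) ^ d := by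
  have hd' : (1 : ℝ) ≤ d := by exact_mod_cast hd
  have h1 : (1 : ℝ) / (2 * d) ≤ 1 := by
    rw [div_le_one (by positivity)]; linarith
  have h := one_add_mul_le_pow (a := -(1 / (2 * d) : ℝ)) (by linarith) d
  have h2 : (d : ℝ) * -(1 / (2 * d)) = -(1 / 2) := by field_simp
  rw [h2] at h
  rw [sub_eq_add_neg]
  linarith

/-- If a probability weight on the grid gives a large weight to the support of each factor, then
few grid points detect all tensors of norm larger than `ε / 2`. -/
theorem exists_detecting_points {r m d N : ℕ} {M ε B : ℝ} (hm : 0 < m) (hd : 1 ≤ d)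
    (hε : ε ∈ Ioo (0 : ℝ) 1) (hB : 0 ≤ B) {w : Fin m → ℝ} (hw : ∀ j, 0 ≤ w j)
    (hw1 : ∑ j, w j = 1)
    (hF : ∀ F ∈ factorClass r M, ∀ x ∈ Icc (0 : ℝ) 1, ε / 2 < |F x| →
      (1 - 1 / (2 * d)) * |F x| ^ B ≤ ∑ j ∈ gridSupport m F, w j)
    (hN : (m * d : ℝ) ≤ 1 / 2 * (ε / 2) ^ B * N) :
    ∃ P : Fin N → Fin d → Fin m, ∀ F : Fin d → ℝ → ℝ, (∀ i, F i ∈ factorClass r M) →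
      (∀ k, ∏ i, F i (gridPoint m (P k i)) = 0) →
      ∀ x : Cube d, |∏ i, F i (x i)| ≤ ε / 2 := by
  classical
  have hd' : (1 : ℝ) ≤ d := by exact_mod_cast hd
  have hε0 : 0 < ε / 2 := half_pos hε.1
  set v := 1 / 2 * (ε / 2) ^ B with hv
  have hv0 : 0 < v := by positivity
  have hv1 : v ≤ 1 := by
    have : (ε / 2) ^ B ≤ 1 := Real.rpow_le_one hε0.le (by linarith [hε.2]) hB
    rw [hv]; linarith
  let W : (Fin d → Fin m) → ℝ := fun z => ∏ i, w (z i)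
  have hWS : ∀ σ : Fin d → Finset (Fin m),
      ∑ z ∈ Fintype.piFinset σ, W z = ∏ i, ∑ j ∈ σ i, w j := fun σ =>
    (Finset.prod_univ_sum σ fun _ j => w j).symm
  have hW1 : ∑ z, W z = 1 := by
    have := hWS fun _ => Finset.univ
    rw [Fintype.piFinset_univ] at this
    rw [this]
    simp [hw1]
  -- Only the support patterns matter, not the tensors, so there are finitely many sets to hit.
  let C : Finset (Fin d → Finset (Fin m)) :=
    Finset.univ.filter fun σ => v ≤ ∑ z ∈ Fintype.piFinset σ, W z
  obtain ⟨P, hP⟩ := exists_card_unhit_le (w := W) (fun z => Finset.prod_nonneg fun i _ => hw _)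
    hW1 (fun σ => Fintype.piFinset σ) C (fun σ hσ => (Finset.mem_filter.1 hσ).2) hv1 N
  have hC : (C.card : ℝ) ≤ (2 : ℝ) ^ (m * d) := by
    have h1 : C.card ≤ Fintype.card (Fin d → Finset (Fin m)) := Finset.card_le_univ _
    rw [Fintype.card_fun, Fintype.card_finset, Fintype.card_fin, Fintype.card_fin,
      ← pow_mul] at h1
    exact_mod_cast h1
  have hlt : (1 - v) ^ N * (C.card : ℝ) < 1 := by
    have h1 : (1 - v) ^ N ≤ Real.exp (-(v * N)) := by
      have := pow_le_pow_left₀ (by linarith : 0 ≤ 1 - v) (Real.one_sub_le_exp_neg v) N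
      rwa [← Real.exp_nat_mul, mul_neg, mul_comm] at this
    have h2 : (2 : ℝ) ^ (m * d) = Real.exp (Real.log 2 * (m * d)) := by
      rw [← Real.rpow_natCast, Real.rpow_def_of_pos two_pos]
      push_cast
      rfl
    have h3 : (0 : ℝ) < m * d := by
      have : (0 : ℝ) < m := by exact_mod_cast hm
      positivity
    calc (1 - v) ^ N * (C.card : ℝ) ≤ Real.exp (-(v * N)) * Real.exp (Real.log 2 * (m * d)) := by
          rw [← h2]
          gcongr
      _ = Real.exp (-(v * N) + Real.log 2 * (m * d)) := (Real.exp_add _ _).symm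
      _ < 1 := by
          rw [Real.exp_lt_one_iff]
          have := Real.log_two_lt_d9
          nlinarith
  have hempty : (C.filter fun σ => ∀ k, P k ∉ Fintype.piFinset σ) = ∅ := by
    rw [← Finset.card_eq_zero]
    have : (((C.filter fun σ => ∀ k, P k ∉ Fintype.piFinset σ).card : ℕ) : ℝ) < 1 :=
      hP.trans_lt hlt
    have h2 : (C.filter fun σ => ∀ k, P k ∉ Fintype.piFinset σ).card < 1 := by exact_mod_cast this
    omega
  refine ⟨P, fun F hFc h0 x => ?_⟩
  by_contra! hx
  rw [Finset.abs_prod] at hx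
  have hle1 : ∀ i, |F i (x i)| ≤ 1 := fun i => abs_le_one_of_mem_factorClass (hFc i) (x i).2
  -- All factors are bounded by 1, so none can be smaller than the product.
  have hi : ∀ i, ε / 2 < |F i (x i)| := fun i => by
    refine hx.trans_le ?_
    rw [← Finset.mul_prod_erase _ _ (Finset.mem_univ i)]
    exact mul_le_of_le_one_right (abs_nonneg _)
      (Finset.prod_le_one (fun _ _ => abs_nonneg _) fun j _ => hle1 j)
  have hq : (0 : ℝ) ≤ 1 - 1 / (2 * d) := by
    have : (1 : ℝ) / (2 * d) ≤ 1 := by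
      rw [div_le_one (by positivity)]; linarith
    linarith
  let σ : Fin d → Finset (Fin m) := fun i => gridSupport m (F i)
  have hσ : σ ∈ C := by
    refine Finset.mem_filter.2 ⟨Finset.mem_univ _, ?_⟩
    rw [hWS]
    calc v ≤ (1 - 1 / (2 * d)) ^ d * (∏ i, |F i (x i)|) ^ B := by
          rw [hv]
          exact mul_le_mul (half_le_one_sub_pow hd)
            (Real.rpow_le_rpow hε0.le hx.le hB) (by positivity) (by positivity)
      _ = ∏ i, (1 - 1 / (2 * d)) * |F i (x i)| ^ B := by
          rw [Finset.prod_mul_distrib, Finset.prod_const, Finset.card_univ, Fintype.card_fin,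
            Real.finsetProd_rpow _ _ fun i _ => abs_nonneg _]
      _ ≤ _ := Finset.prod_le_prod (fun i _ => by positivity)
          fun i _ => hF _ (hFc i) _ (x i).2 (hi i)
  have : σ ∉ C.filter fun σ => ∀ k, P k ∉ Fintype.piFinset σ := by
    rw [hempty]; exact Finset.notMem_empty _
  rw [Finset.mem_filter, not_and] at this
  have h1 := this hσ
  push Not at h1
  obtain ⟨k, hk⟩ := h1
  rw [Fintype.mem_piFinset] at hk
  refine absurd (h0 k) (Finset.prod_ne_zero_iff.2 fun i _ => ?_)
  exact (Finset.mem_filter.1 (hk i)).2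

/-! ### Recovery along grid lines and the general upper bound -/

/-- The approximants `b i` may exceed 1, but only up to `1 + δ`, which is why the telescoping bound
is exponential rather than `d δ`. -/
theorem abs_prod_sub_prod_le {d : ℕ} {a b : Fin d → ℝ} {δ : ℝ} (hδ : 0 ≤ δ)
    (ha : ∀ i, |a i| ≤ 1) (hab : ∀ i, |a i - b i| ≤ δ) :
    |∏ i, a i - ∏ i, b i| ≤ (1 + δ) ^ d - 1 := by
  induction d with
  | zero => simp
  | succ d ih =>
    rw [Fin.prod_univ_succ, Fin.prod_univ_succ]
    have h1 := ih (a := fun i => a i.succ) (b := fun i => b i.succ) (fun i => ha _) fun i => hab _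
    set p := ∏ i : Fin d, a i.succ with hp
    set q := ∏ i : Fin d, b i.succ
    have hp1 : |p| ≤ 1 := by
      rw [hp, Finset.abs_prod]
      exact Finset.prod_le_one (fun _ _ => abs_nonneg _) fun i _ => ha _
    have hb : |b 0| ≤ 1 + δ := by
      have h2 := abs_sub_abs_le_abs_sub (b 0) (a 0)
      rw [abs_sub_comm] at h2
      linarith [ha 0, hab 0]
    have h3 : a 0 * p - b 0 * q = (a 0 - b 0) * p + b 0 * (p - q) := by ring
    calc |a 0 * p - b 0 * q| ≤ |(a 0 - b 0) * p| + |b 0 * (p - q)| := by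
          rw [h3]; exact abs_add_le _ _
      _ = |a 0 - b 0| * |p| + |b 0| * |p - q| := by rw [abs_mul, abs_mul]
      _ ≤ δ * 1 + (1 + δ) * ((1 + δ) ^ d - 1) := by
          gcongr
          exact hab 0
      _ = (1 + δ) ^ (d + 1) - 1 := by ring

/-- Tensors that agree on the grid lines through a point where they do not vanish are close. -/
theorem abs_sub_le_of_agree_on_lines {r m d : ℕ} (hr : 1 ≤ r) (hrm : r ≤ m) {M ε : ℝ}
    (hM : 0 ≤ M) (hd : 1 ≤ d) (hε : ε ∈ Ioo (0 : ℝ) 1)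
    (hδ : M / r.factorial * ((r : ℝ) / m) ^ r ≤ ε / (8 * d)) {F G : Fin d → ℝ → ℝ}
    (hF : ∀ i, F i ∈ factorClass r M) (hG : ∀ i, G i ∈ factorClass r M) (z : Cube d)
    (hz : ∏ i, F i (z i) ≠ 0) (hz' : ∏ i, F i (z i) = ∏ i, G i (z i))
    (hline : ∀ i j, ∏ l, F l (Function.update z i (gridPoint m j) l)
      = ∏ l, G l (Function.update z i (gridPoint m j) l)) (x : Cube d) :
    |∏ i, F i (x i) - ∏ i, G i (x i)| ≤ ε := by
  have hd' : (1 : ℝ) ≤ d := by exact_mod_cast hd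
  set δ := M / r.factorial * ((r : ℝ) / m) ^ r with hδdef
  have hδ0 : 0 ≤ δ := by positivity
  choose c hc using fun i => exists_grid_weights hr hrm (x i).2
  have hsmall : (1 + δ) ^ d - 1 ≤ ε / 2 := by
    have h1 : (1 + δ) ^ d ≤ Real.exp (d * δ) := by
      have := pow_le_pow_left₀ (by linarith : 0 ≤ 1 + δ)
        ((add_comm 1 δ).trans_le (Real.add_one_le_exp δ)) d
      rwa [← Real.exp_nat_mul] at this
    have h2 : d * δ ≤ ε / 8 := by
      rw [le_div_iff₀ (by positivity)] at hδ
      linarith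
    have h3 : 0 ≤ d * δ := by positivity
    have h4 := Real.abs_exp_sub_one_le (x := d * δ) (by
      rw [abs_of_nonneg h3]; linarith [hε.2])
    rw [abs_of_nonneg h3] at h4
    linarith [le_abs_self (Real.exp (d * δ) - 1)]
  have key : ∀ H : Fin d → ℝ → ℝ, (∀ i, H i ∈ factorClass r M) →
      |∏ i, H i (x i) - ∏ i, ∑ j, H i (gridPoint m j) * c i j| ≤ ε / 2 := fun H hH =>
    (abs_prod_sub_prod_le hδ0 (fun i => abs_le_one_of_mem_factorClass (hH i) (x i).2)
      fun i => hc i M hM _ (hH i)).trans hsmall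
  have hupd : ∀ (H : Fin d → ℝ → ℝ) (i : Fin d) (t : unitInterval),
      (∏ l, H l (Function.update z i t l)) * H i (z i) = H i t * ∏ l, H l (z l) := by
    intro H i t
    rw [← Finset.mul_prod_erase _ _ (Finset.mem_univ i),
      ← Finset.mul_prod_erase Finset.univ (fun l => H l (z l)) (Finset.mem_univ i)]
    have : ∏ l ∈ Finset.univ.erase i, H l (Function.update z i t l)
        = ∏ l ∈ Finset.univ.erase i, H l (z l) :=
      Finset.prod_congr rfl fun l hl => by rw [Function.update_of_ne (Finset.ne_of_mem_erase hl)]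
    rw [this, Function.update_self]
    ring
  have hFz : ∀ i, F i (z i) ≠ 0 := fun i => Finset.prod_ne_zero_iff.1 hz i (Finset.mem_univ i)
  have hGz : ∀ i, G i (z i) ≠ 0 := fun i =>
    Finset.prod_ne_zero_iff.1 (hz' ▸ hz) i (Finset.mem_univ i)
  -- The line in direction `i` fixes `F i` up to the scalar `F i (z i)`. So `F i` and `G i` are
  -- proportional on the grid, and the constants of proportionality multiply to 1 by `hz'`.
  have hratio : ∀ i j, F i (gridPoint m j) * G i (z i) = G i (gridPoint m j) * F i (z i) := by
    intro i j
    have h1 := hupd F i (gridPoint m j)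
    have h2 := hupd G i (gridPoint m j)
    rw [← hline, ← hz'] at h2
    refine mul_right_cancel₀ hz ?_
    linear_combination (-(G i (z i))) * h1 + F i (z i) * h2
  have hsum : ∀ i, (∑ j, F i (gridPoint m j) * c i j) * G i (z i)
      = (∑ j, G i (gridPoint m j) * c i j) * F i (z i) := by
    intro i
    rw [Finset.sum_mul, Finset.sum_mul]
    exact Finset.sum_congr rfl fun j _ => by linear_combination c i j * hratio i j
  have hprod : ∏ i, ∑ j, F i (gridPoint m j) * c i j = ∏ i, ∑ j, G i (gridPoint m j) * c i j := by
    have h1 := Finset.prod_congr rfl fun (i : Fin d) (_ : i ∈ Finset.univ) => hsum i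
    rw [Finset.prod_mul_distrib, Finset.prod_mul_distrib, ← hz'] at h1
    exact mul_right_cancel₀ hz h1
  have h1 := key F hF
  have h2 := key G hG
  rw [hprod] at h1
  rw [abs_sub_comm] at h2
  calc _ ≤ _ := abs_sub_le _ (∏ i, ∑ j, G i (gridPoint m j) * c i j) _
    _ ≤ ε := by linarith

/-- The upper bound for the information complexity from detecting weights on a grid. -/
theorem complexity_le_of_weight {r m d N : ℕ} (hr : 1 ≤ r) (hrm : r ≤ m) {M ε B : ℝ}
    (hM : 0 ≤ M) (hd : 1 ≤ d) (hε : ε ∈ Ioo (0 : ℝ) 1) (hB : 0 ≤ B)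
    (hδ : M / r.factorial * ((r : ℝ) / m) ^ r ≤ ε / (8 * d)) {w : Fin m → ℝ}
    (hw : ∀ j, 0 ≤ w j) (hw1 : ∑ j, w j = 1)
    (hF : ∀ F ∈ factorClass r M, ∀ x ∈ Icc (0 : ℝ) 1, ε / 2 < |F x| →
      (1 - 1 / (2 * d)) * |F x| ^ B ≤ ∑ j ∈ gridSupport m F, w j)
    (hN : (m * d : ℝ) ≤ 1 / 2 * (ε / 2) ^ B * N) :
    complexity r M ε d ≤ (N * (d * m) : ℕ) := by
  obtain ⟨P, hP⟩ := exists_detecting_points (by omega) hd hε hB hw hw1 hF hN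
  let z : Fin N → Cube d := fun k i => gridPoint m (P k i)
  let e : Fin (N * (d * m)) ≃ Fin N × Fin d × Fin m :=
    finProdFinEquiv.symm.trans ((Equiv.refl _).prodCongr finProdFinEquiv.symm)
  let Q : Fin (N * (d * m)) → Cube d := fun k =>
    Function.update (z (e k).1) (e k).2.1 (gridPoint m (e k).2.2)
  refine complexity_le_of_determined Q ?_
  rintro _ ⟨F, hFc, rfl⟩ _ ⟨G, hGc, rfl⟩ hag x
  have hline : ∀ k i j, ∏ l, F l (Function.update (z k) i (gridPoint m j) l)
      = ∏ l, G l (Function.update (z k) i (gridPoint m j) l) := by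
    intro k i j
    have := hag (e.symm (k, i, j))
    simpa [Q] using this
  -- The detecting point lies on its own grid lines, so it needs no separate sample.
  have hpt : ∀ k, ∏ i, F i (z k i) = ∏ i, G i (z k i) := by
    intro k
    have h := hline k ⟨0, hd⟩ (P k ⟨0, hd⟩)
    have h1 : Function.update (z k) ⟨0, hd⟩ (gridPoint m (P k ⟨0, hd⟩)) = z k :=
      Function.update_eq_self _ _
    rwa [h1] at h
  by_cases hz : ∀ k, ∏ i, F i (z k i) = 0
  · have h1 := hP F hFc hz x
    have h2 := hP G hGc (fun k => (hpt k).symm.trans (hz k)) x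
    exact (abs_sub _ _).trans (by linarith)
  · push Not at hz
    obtain ⟨k, hk⟩ := hz
    exact abs_sub_le_of_agree_on_lines hr hrm hM hd hε hδ hFc hGc (z k) hk (hpt k) (hline k) x

/-- Taking `N = ⌈m d / v⌉` with `v = (ε/2)^B / 2`, the count `N d m` is at most `2 m² d² / v`. The
first power of `r / m` suffices because `r / m ≤ 1`. -/
theorem coe_complexity_le_of_weight {r m d : ℕ} (hr : 1 ≤ r) (hrm : r ≤ m) {M ε B C : ℝ}
    (hM : 0 ≤ M) (hd : 1 ≤ d) (hε : ε ∈ Ioo (0 : ℝ) 1) (hB : 0 ≤ B)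
    (hδ : M / r.factorial * ((r : ℝ) / m) ≤ ε / (8 * d)) {w : Fin m → ℝ}
    (hw : ∀ j, 0 ≤ w j) (hw1 : ∑ j, w j = 1)
    (hF : ∀ F ∈ factorClass r M, ∀ x ∈ Icc (0 : ℝ) 1, ε / 2 < |F x| →
      (1 - 1 / (2 * d)) * |F x| ^ B ≤ ∑ j ∈ gridSupport m F, w j)
    (hmC : (m : ℝ) ≤ C * d / ε) :
    (complexity r M ε d : ℝ≥0∞) ≤
      ENNReal.ofReal (4 * C ^ 2 * d ^ 4 * (1 / ε) ^ 2 * (2 / ε) ^ B) := by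
  have hd' : (1 : ℝ) ≤ d := by exact_mod_cast hd
  have hm' : (1 : ℝ) ≤ m := by exact_mod_cast hr.trans hrm
  have hε0 := hε.1
  have hδ' : M / r.factorial * ((r : ℝ) / m) ^ r ≤ ε / (8 * d) := by
    refine le_trans ?_ hδ
    gcongr
    refine pow_le_of_le_one (by positivity) ?_ (by omega)
    rw [div_le_one (by positivity)]
    exact_mod_cast hrm
  set v := 1 / 2 * (ε / 2) ^ B with hv
  have hv0 : 0 < v := by positivity
  have hv1 : v ≤ 1 := by
    have : (ε / 2) ^ B ≤ 1 := Real.rpow_le_one (by positivity) (by linarith [hε.2]) hB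
    rw [hv]; linarith
  set N := ⌈m * d / v⌉₊ with hN
  have h1 : (m * d : ℝ) ≤ v * N := by
    have := Nat.le_ceil (m * d / v : ℝ)
    rw [div_le_iff₀ hv0] at this
    linarith
  have h2 := complexity_le_of_weight hr hrm hM hd hε hB hδ' hw hw1 hF h1
  have h3 : (N : ℝ) ≤ 2 * (m * d / v) := by
    have h4 := Nat.ceil_lt_add_one (by positivity : (0 : ℝ) ≤ m * d / v)
    have h5 : (1 : ℝ) ≤ m * d / v := by
      rw [le_div_iff₀ hv0]
      nlinarith
    linarith
  have h6 : 1 / v = 2 * (2 / ε) ^ B := by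
    rw [hv, ← inv_div ε 2, Real.inv_rpow (by positivity)]
    field_simp
  have h7 : ((N * (d * m) : ℕ) : ℝ) ≤ 4 * C ^ 2 * d ^ 4 * (1 / ε) ^ 2 * (2 / ε) ^ B := by
    push_cast
    calc (N : ℝ) * (d * m) ≤ 2 * (m * d / v) * (d * m) := by gcongr
      _ = 2 * d ^ 2 * (m : ℝ) ^ 2 * (1 / v) := by ring
      _ ≤ 2 * d ^ 2 * (C * d / ε) ^ 2 * (1 / v) := by gcongr
      _ = _ := by rw [h6]; ring
  calc (complexity r M ε d : ℝ≥0∞) ≤ (((N * (d * m) : ℕ) : ℕ∞) : ℝ≥0∞) :=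
        ENat.toENNReal_le.2 h2
    _ = ENNReal.ofReal ((N * (d * m) : ℕ) : ℝ) := by
        rw [ENNReal.ofReal_natCast, ENat.toENNReal_coe]
    _ ≤ _ := ENNReal.ofReal_le_ofReal h7

/-! ### Choice of the weight and tractability -/

/-- Since `M / r! ≤ 1`, the radius `ρ = |F x|` is allowed, so the support fills a proportion `|F x|
- r/m` of the grid. The choice of `m` absorbs `r/m` into the factor `1 - 1/(2d)`, and the uniform
weight works with `B = 1`. -/
theorem polynomiallyTractable {r : ℕ} (hr : 1 ≤ r) {M : ℝ} (hM : 0 < M)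
    (hMr : M ≤ r.factorial) : PolynomiallyTractable r M := by
  have hr' : (1 : ℝ) ≤ r := by exact_mod_cast hr
  have hκ : M / r.factorial ≤ 1 := div_le_one_of_le₀ hMr (by positivity)
  refine ⟨8 * (16 * r) ^ 2, by positivity, 4, by norm_num, 3, by norm_num, fun ε hε d hd => ?_⟩
  have hε0 := hε.1
  have hd' : (1 : ℝ) ≤ d := by exact_mod_cast hd
  set m := ⌈8 * r * d / ε⌉₊ with hm
  have hx1 : (1 : ℝ) ≤ 8 * r * d / ε := by
    rw [le_div_iff₀ hε0]
    nlinarith [hε.2, mul_le_mul hr' hd' zero_le_one (by linarith)]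
  have hm1 : 8 * r * d / ε ≤ m := Nat.le_ceil _
  have hm2 : (m : ℝ) ≤ 16 * r * d / ε := by
    have := Nat.ceil_lt_add_one (by positivity : (0 : ℝ) ≤ 8 * r * d / ε)
    have h : 16 * (r : ℝ) * d / ε = 8 * r * d / ε + 8 * r * d / ε := by ring
    linarith
  have hm0 : (0 : ℝ) < m := by linarith
  have hm0' : 0 < m := by exact_mod_cast hm0
  have hrm_div : (r : ℝ) / m ≤ ε / (8 * d) := by
    rw [div_le_div_iff₀ hm0 (by positivity)]
    rw [div_le_iff₀ hε0] at hm1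
    linarith
  have hrm : r ≤ m := by
    have h : (r : ℝ) / m ≤ 1 := hrm_div.trans (by
      rw [div_le_one (by positivity)]; linarith [hε.2])
    rw [div_le_one hm0] at h
    exact_mod_cast h
  have hmain := coe_complexity_le_of_weight (C := 16 * r) (B := 1) (w := fun _ : Fin m => 1 / (m : ℝ))
    hr hrm hM.le hd hε zero_le_one
    ((mul_le_of_le_one_left (by positivity) hκ).trans hrm_div)
    (fun _ => by positivity) (by simp [hm0.ne']) (fun F hF x hx hFx => ?_) hm2
  · refine hmain.trans (ENNReal.ofReal_le_ofReal (le_of_eq ?_))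
    rw [Real.rpow_one, Real.rpow_neg hε0.le]
    have h3 : ε ^ (3 : ℝ) = ε ^ 3 := by exact_mod_cast Real.rpow_natCast ε 3
    have h4 : (d : ℝ) ^ (4 : ℝ) = d ^ 4 := by exact_mod_cast Real.rpow_natCast (d : ℝ) 4
    rw [h3, h4]
    field_simp
    norm_num
  · have hs1 := abs_le_one_of_mem_factorClass hF hx
    have hs0 : 0 < |F x| := lt_trans (by linarith) hFx
    have h1 := le_card_gridSupport hr hm0' hM hF hx hs0 hs1 (by
      have : |F x| ^ r ≤ |F x| := pow_le_of_le_one hs0.le hs1 (by omega)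
      have h0 : 0 ≤ |F x| ^ r := by positivity
      nlinarith)
    rw [Finset.sum_const, nsmul_eq_mul, mul_one_div, le_div_iff₀ hm0, Real.rpow_one]
    have h2 : (r : ℝ) ≤ |F x| / (2 * d) * m := by
      rw [div_le_iff₀ hm0] at hrm_div
      refine hrm_div.trans ?_
      gcongr ?_ * _
      rw [div_le_div_iff₀ (by positivity) (by positivity)]
      nlinarith
    have h3 : (1 - 1 / (2 * d)) * |F x| * m = |F x| * m - |F x| / (2 * d) * m := by ring
    rw [h3]
    linarith

/-- The exponent of `2/ε` grows like `log d`, which yields the product of logarithms; the powers of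
`d` and `1/ε` are absorbed. -/
theorem quasiPolynomial_growth {C a ε d : ℝ} (ha : 0 < a) (hε : ε ∈ Ioo (0 : ℝ) 1) (hd : 1 ≤ d) :
    4 * C ^ 2 * d ^ 4 * (1 / ε) ^ 2 * (2 / ε) ^ (1 + Real.log (16 * d) / a) ≤
      4 * C ^ 2 * Real.exp ((7 + 3 / a) * (1 + Real.log ε⁻¹) * (1 + Real.log d)) := by
  have hε0 := hε.1
  have hd0 : 0 < d := by linarith
  have hl0 : 0 ≤ Real.log ε⁻¹ := Real.log_nonneg ((one_le_inv₀ hε0).2 hε.2.le)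
  have hL0 : 0 ≤ Real.log d := Real.log_nonneg hd
  have hd4 : d ^ 4 = Real.exp (4 * Real.log d) := by
    have := Real.exp_nat_mul (Real.log d) 4
    rw [Real.exp_log hd0] at this
    rw [← this]; norm_num
  have he2 : (1 / ε) ^ 2 = Real.exp (2 * Real.log ε⁻¹) := by
    have := Real.exp_nat_mul (Real.log ε⁻¹) 2
    rw [Real.exp_log (by positivity)] at this
    rw [one_div, ← this]; norm_num
  have hBexp (B : ℝ) : (2 / ε) ^ B = Real.exp ((Real.log 2 + Real.log ε⁻¹) * B) := by
    rw [Real.rpow_def_of_pos (by positivity), div_eq_mul_inv,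
      Real.log_mul two_ne_zero (by positivity)]
  have hlog2 : Real.log 2 ≤ 1 := by linarith [Real.log_two_lt_d9]
  have hA0 : 0 ≤ Real.log (16 * d) / a := div_nonneg (Real.log_nonneg (by linarith)) ha.le
  have hAle : 1 + Real.log (16 * d) / a ≤ (1 + 3 / a) * (1 + Real.log d) := by
    have h16 : Real.log (16 * d) = 4 * Real.log 2 + Real.log d := by
      rw [Real.log_mul (by norm_num) hd0.ne', (by norm_num : (16 : ℝ) = 2 ^ 4), Real.log_pow]
      norm_num
    have h1 : Real.log (16 * d) ≤ 3 * (1 + Real.log d) := by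
      rw [h16]; linarith [Real.log_two_lt_d9]
    have h2 : Real.log (16 * d) / a ≤ 3 / a * (1 + Real.log d) := by
      rw [div_mul_eq_mul_div]
      exact div_le_div_of_nonneg_right h1 ha.le
    linarith
  rw [hd4, he2, hBexp]
  generalize Real.log d = L at *
  generalize Real.log ε⁻¹ = l at *
  generalize Real.log (16 * d) / a = A at *
  have h1 : (Real.log 2 + l) * (1 + A) ≤ (1 + l) * ((1 + 3 / a) * (1 + L)) :=
    mul_le_mul (by linarith) hAle (by linarith) (by linarith)
  have h2 : 4 * L + 2 * l + (Real.log 2 + l) * (1 + A) ≤ (7 + 3 / a) * (1 + l) * (1 + L) := by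
    nlinarith [mul_nonneg hl0 hL0]
  calc 4 * C ^ 2 * Real.exp (4 * L) * Real.exp (2 * l) * Real.exp ((Real.log 2 + l) * (1 + A))
      = 4 * C ^ 2 * Real.exp (4 * L + 2 * l + (Real.log 2 + l) * (1 + A)) := by
        rw [Real.exp_add, Real.exp_add]; ring
    _ ≤ _ := mul_le_mul_of_nonneg_left (Real.exp_le_exp.2 h2) (by positivity)

/-- A mixture of the uniform weight on a central interval and of the uniform weight on the whole
grid gives large weight to the supports of functions of the class. -/
theorem exists_weight_of_lt {r m d : ℕ} (hr : 1 ≤ r) (hd : 1 ≤ d) {M b A ε : ℝ} (hM : 0 < M)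
    (hMr : M / r.factorial ≤ 2 ^ r) (hb : 1 / 2 < b) (hA0 : 0 ≤ A)
    (hA : (M / r.factorial * b ^ r) ^ A = 1 / (16 * d)) (hε0 : 0 < ε) (hmε : 8 * r ≤ m * ε)
    (hD : 4 * r * d ≤ ((gridIn m (1 - b) b).card : ℝ)) :
    ∃ w : Fin m → ℝ, (∀ j, 0 ≤ w j) ∧ ∑ j, w j = 1 ∧
      ∀ F ∈ factorClass r M, ∀ x ∈ Icc (0 : ℝ) 1, ε / 2 < |F x| →
        (1 - 1 / (2 * d)) * |F x| ^ (1 + A) ≤ ∑ j ∈ gridSupport m F, w j := by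
  classical
  have hr' : (1 : ℝ) ≤ r := by exact_mod_cast hr
  have hd' : (1 : ℝ) ≤ d := by exact_mod_cast hd
  have hb0 : 0 < b := by linarith
  have hm0 : (0 : ℝ) < m := pos_of_mul_pos_left (by linarith : 0 < m * ε) hε0.le
  have hm0' : 0 < m := by exact_mod_cast hm0
  generalize hDdef : gridIn m (1 - b) b = D at hD
  generalize hκdef : M / r.factorial = κ at hA hMr
  have hD0 : (0 : ℝ) < D.card := lt_of_lt_of_le (by positivity) hD
  -- The uniform part gets mass `p`, small enough that `(1 - p)² ≥ 1 - 2p = 1 - 1/(2d)`.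
  set p : ℝ := 1 / (4 * d) with hp
  have hp0 : 0 < p := by positivity
  have hp1 : p ≤ 1 / 4 := by
    rw [hp]
    exact one_div_le_one_div_of_le (by norm_num) (by linarith)
  have hp2 : 1 / (2 * d : ℝ) = 2 * p := by rw [hp]; field_simp; norm_num
  let w : Fin m → ℝ := fun j => (1 - p) * (if j ∈ D then 1 / (D.card : ℝ) else 0) + p * (1 / m)
  have hwS : ∀ S : Finset (Fin m),
      ∑ j ∈ S, w j = (1 - p) * ((D ∩ S).card / D.card) + p * (S.card / m) := by
    intro S
    simp only [w]
    rw [Finset.sum_add_distrib, ← Finset.mul_sum, ← Finset.mul_sum, ← Finset.sum_filter,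
      Finset.filter_mem_eq_inter, Finset.inter_comm]
    simp [div_eq_mul_inv]
  have hw0 : ∀ j, 0 ≤ w j := fun j =>
    add_nonneg (mul_nonneg (by linarith) (by split_ifs <;> positivity)) (by positivity)
  have hw1 : ∑ j, w j = 1 := by
    rw [hwS, Finset.inter_univ, div_self hD0.ne', Finset.card_univ, Fintype.card_fin,
      div_self hm0.ne']
    ring
  refine ⟨w, hw0, hw1, fun F hF x hx hFx => ?_⟩
  have hs1 := abs_le_one_of_mem_factorClass hF hx
  set s := |F x| with hs
  have hs0 : 0 < s := lt_trans (by linarith) hFx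
  rw [hwS, hp2]
  -- A large value excludes `r` grid zeros within distance `b` of `x`, and `(1 - b, b)` lies within
  -- that distance of every `x` in `[0,1]`.
  rcases le_or_gt (κ * b ^ r) s with hsθ | hsθ
  · have h1 := card_gridIn_le (m := m) (a := 1 - b) (b := b) hr hM hF hx hb0 (hκdef ▸ hsθ)
      (fun y hy => by
        rw [abs_lt]
        constructor <;> linarith [hy.1, hy.2, hx.1, hx.2])
    rw [hDdef] at h1
    have h2 : 1 - p ≤ (D ∩ gridSupport m F).card / (D.card : ℝ) := by
      rw [le_div_iff₀ hD0]
      have h3 : (r : ℝ) ≤ p * D.card := by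
        rw [hp, one_div_mul_eq_div, le_div_iff₀ (by positivity)]
        linarith
      linarith
    have h4 : s ^ (1 + A) ≤ 1 := Real.rpow_le_one hs0.le hs1 (by positivity)
    have h5 : 0 ≤ p * ((gridSupport m F).card / (m : ℝ)) := by positivity
    calc (1 - 2 * p) * s ^ (1 + A) ≤ 1 - 2 * p := mul_le_of_le_one_right (by linarith) h4
      _ ≤ (1 - p) * (1 - p) := by nlinarith
      _ ≤ (1 - p) * ((D ∩ gridSupport m F).card / (D.card : ℝ)) := by
          gcongr
          linarith
      _ ≤ _ := by linarith
  -- For small `s` the uniform part alone suffices. Radius `s/2` is allowed because `κ ≤ 2^r`, and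
  -- `s < κ b^r` gives `s^A ≤ 1/(16d)`, which matches `p / 4`.
  · have h1 := le_card_gridSupport hr hm0' hM hF hx (half_pos hs0) (by linarith) (by
      have h0 : s ^ r ≤ s := pow_le_of_le_one hs0.le hs1 (by omega)
      rw [hκdef, div_pow, mul_div_assoc', div_le_iff₀ (by positivity)]
      have h00 : 0 ≤ s ^ r := by positivity
      calc κ * s ^ r ≤ 2 ^ r * s ^ r := by gcongr
        _ ≤ 2 ^ r * s := by gcongr
        _ = s * 2 ^ r := mul_comm _ _)
    have h2 : s / 4 ≤ (gridSupport m F).card / (m : ℝ) := by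
      rw [le_div_iff₀ hm0]
      have h3 : (r : ℝ) ≤ s / 4 * m := by nlinarith
      linarith
    have h3 : s ^ (1 + A) ≤ s * (1 / (16 * d)) := by
      rw [Real.rpow_add hs0, Real.rpow_one, ← hA]
      gcongr
    have h4 : p * (s / 4) = s * (1 / (16 * d)) := by rw [hp]; field_simp; norm_num
    have h5 : 0 ≤ (1 - p) * ((D ∩ gridSupport m F).card / (D.card : ℝ)) :=
      mul_nonneg (by linarith) (by positivity)
    have h6 : p * (s / 4) ≤ p * ((gridSupport m F).card / (m : ℝ)) := by gcongr
    have h7 : 0 ≤ s ^ (1 + A) := by positivity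
    calc (1 - 2 * p) * s ^ (1 + A) ≤ s ^ (1 + A) := mul_le_of_le_one_left h7 (by linarith)
      _ ≤ _ := by linarith


/-- Strictness of `M < 2^r r!` leaves room for `b > 1/2` with `θ = κ b^r < 1`; the exponent `A`
solves `θ^A = 1/(16d)`. -/
theorem quasiPolynomiallyTractable {r : ℕ} (hr : 1 ≤ r) {M : ℝ} (hM : 0 < M)
    (hMr : M < 2 ^ r * r.factorial) : QuasiPolynomiallyTractable r M := by
  have hr' : (1 : ℝ) ≤ r := by exact_mod_cast hr
  have hfac : (0 : ℝ) < r.factorial := by exact_mod_cast r.factorial_pos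
  set κ := M / r.factorial with hκdef
  have hκ0 : 0 < κ := by positivity
  have hκ : κ < 2 ^ r := by rwa [hκdef, div_lt_iff₀ hfac]
  obtain ⟨b, hb, hb1, hbθ⟩ : ∃ b : ℝ, 1 / 2 < b ∧ b < 1 ∧ κ * b ^ r < 1 := by
    have h1 : ∀ᶠ b in nhds (1 / 2 : ℝ), κ * b ^ r < 1 := by
      have hc : Continuous fun b : ℝ => κ * b ^ r := by fun_prop
      refine (hc.tendsto _).eventually_lt_const ?_
      rw [div_pow, one_pow, mul_one_div, div_lt_one (by positivity)]
      exact hκ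
    have h2 : ∀ᶠ b in nhdsWithin (1 / 2 : ℝ) (Ioi (1 / 2)), b ∈ Ioo (1 / 2 : ℝ) 1 :=
      Ioo_mem_nhdsGT (by norm_num)
    obtain ⟨b, hb, hb'⟩ := ((h1.filter_mono nhdsWithin_le_nhds).and h2).exists
    exact ⟨b, hb'.1, hb'.2, hb⟩
  set θ := κ * b ^ r with hθdef
  have hb0 : 0 < b := by linarith
  have hθ0 : 0 < θ := by positivity
  set a := -Real.log θ with hadef
  have ha : 0 < a := by
    have := Real.log_neg hθ0 hbθ
    linarith
  have hb2 : 0 < 2 * b - 1 := by linarith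
  -- The first term makes the grid fine enough for interpolation and for small values; the second
  -- puts at least `4 r d` grid points into `(1 - b, b)`.
  set C₀ := 8 * r * (1 + κ) + 5 * r / (2 * b - 1) with hC₀def
  have hC₀ : 8 * r * (1 + κ) ≤ C₀ := by
    have : 0 ≤ 5 * r / (2 * b - 1) := by positivity
    linarith
  have hC₀' : 5 * r / (2 * b - 1) ≤ C₀ := by
    have : 0 ≤ 8 * r * (1 + κ) := by positivity
    linarith
  have hC₀8 : 8 * r ≤ C₀ := by nlinarith
  have hC₀0 : 0 < C₀ := by linarith
  refine ⟨4 * (2 * C₀) ^ 2, by positivity, 7 + 3 / a, by positivity, fun ε hε d hd => ?_⟩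
  have hε0 := hε.1
  have hd' : (1 : ℝ) ≤ d := by exact_mod_cast hd
  set m := ⌈C₀ * d / ε⌉₊ with hm
  have hm1 : C₀ * d / ε ≤ m := Nat.le_ceil _
  have hm1' : C₀ * d ≤ m * ε := by rwa [div_le_iff₀ hε0] at hm1
  have hmd : C₀ * d ≤ m := hm1'.trans (mul_le_of_le_one_right (by positivity) hε.2.le)
  have hC₀d : C₀ ≤ C₀ * d := le_mul_of_one_le_right hC₀0.le hd'
  have hm2 : (m : ℝ) ≤ 2 * C₀ * d / ε := by
    have := Nat.ceil_lt_add_one (by positivity : (0 : ℝ) ≤ C₀ * d / ε)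
    have h : 2 * C₀ * d / ε = C₀ * d / ε + C₀ * d / ε := by ring
    have h1 : (1 : ℝ) ≤ C₀ * d / ε := by
      rw [le_div_iff₀ hε0]
      linarith [hε.2]
    linarith
  have hm0 : (0 : ℝ) < m := by linarith
  have hm0' : 0 < m := by exact_mod_cast hm0
  have hrm : r ≤ m := by
    have : (r : ℝ) ≤ m := by linarith
    exact_mod_cast this
  set A := Real.log (16 * d) / a with hAdef
  have hlog16 : 0 ≤ Real.log (16 * d) := Real.log_nonneg (by linarith)
  have hA0 : 0 ≤ A := by positivity
  have hθA : θ ^ A = 1 / (16 * d) := by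
    rw [Real.rpow_def_of_pos hθ0]
    have : Real.log θ * A = -Real.log (16 * d) := by
      rw [hAdef, hadef]
      have : Real.log θ ≠ 0 := by linarith
      field_simp
    rw [this, Real.exp_neg, Real.exp_log (by positivity), one_div]
  have hDcard : 4 * r * d ≤ ((gridIn m (1 - b) b).card : ℝ) := by
    have h1 := le_card_gridIn hm0' (a := 1 - b) (b := b) (by linarith) hb1.le
    have h2 : 5 * r * d ≤ (2 * b - 1) * m := by
      have h3 : 5 * r / (2 * b - 1) * d ≤ m := by
        have : 5 * r / (2 * b - 1) * d ≤ C₀ * d := by gcongr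
        linarith
      rw [div_mul_eq_mul_div, div_le_iff₀ hb2] at h3
      linarith
    have h3 : (1 : ℝ) ≤ r * d := one_le_mul_of_one_le_of_one_le hr' hd'
    have h4 : (b - (1 - b)) * m = (2 * b - 1) * m := by ring
    rw [h4] at h1
    linarith
  obtain ⟨w, hw0, hw1, hw⟩ := exists_weight_of_lt (A := A) (ε := ε) hr hd hM hκ.le hb hA0 hθA hε0
    (by linarith) hDcard
  have hmain := coe_complexity_le_of_weight (C := 2 * C₀) (B := 1 + A) hr hrm hM.le hd hε
    (by positivity) (by
      rw [mul_div_assoc', div_le_div_iff₀ hm0 (by positivity)]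
      have h1 : 8 * r * κ ≤ C₀ := by nlinarith
      have h2 : 8 * r * κ * d ≤ C₀ * d := by gcongr
      linarith) hw0 hw1 hw hm2
  exact hmain.trans (ENNReal.ofReal_le_ofReal (quasiPolynomial_growth ha hε hd'))

/-! ### Fooling functions for adaptive algorithms -/

theorem complexity_antitone {r : ℕ} {M ε ε' : ℝ} (h : ε' ≤ ε) (d : ℕ) :
    complexity r M ε d ≤ complexity r M ε' d :=
  le_iInf₂ fun _ hn =>
    complexity_le_of_minimalError_le (hn.trans (ENNReal.ofReal_le_ofReal h))

/-- The open interval is dense in `[0,1]`. This is what turns almost-everywhere bounds for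
continuous tensors into pointwise ones. -/
theorem volume_unitInterval_isOpenPosMeasure :
    (volume : Measure unitInterval).IsOpenPosMeasure := by
  refine ⟨fun U hU hne h0 => ?_⟩
  obtain ⟨V, hV, rfl⟩ := isOpen_induced_iff.1 hU
  obtain ⟨x, hx⟩ := hne
  rw [Measure.Subtype.volume_def, comap_subtype_coe_apply measurableSet_Icc,
    Subtype.image_preimage_coe] at h0
  have hcl : (x : ℝ) ∈ closure (Ioo (0 : ℝ) 1) := by
    rw [closure_Ioo zero_ne_one]; exact x.2
  have hne : (V ∩ Ioo (0 : ℝ) 1).Nonempty := mem_closure_iff.1 hcl V hV hx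
  have hpos := (hV.inter isOpen_Ioo).measure_pos volume hne
  have hle : volume (V ∩ Ioo (0 : ℝ) 1) ≤ volume (unitInterval ∩ V) :=
    measure_mono fun y hy => ⟨Ioo_subset_Icc_self hy.2, hy.1⟩
  rw [h0] at hle
  exact absurd hpos (not_lt.2 hle)

/-- Agreement is required only at the nodes visited on input `g`; adaptivity then cannot separate
the two inputs. -/
theorem Algorithm.values_eq_of_forall_eq {d m : ℕ} (A : Algorithm d m) {f g : Cube d → ℝ} {k : ℕ}
    (h : ∀ i < k, f (A.node i (A.values g i)) = g (A.node i (A.values g i))) :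
    A.values f k = A.values g k := by
  induction k with
  | zero => rfl
  | succ k ih =>
    have h1 := ih fun i hi => h i (by omega)
    simp only [Algorithm.values]
    rw [h1, h k (by omega)]

/-- If for all `n` points there is a function in the class, of norm at least `σ > ε`, that vanishes
at these points, then `n` function values do not suffice. -/
theorem succ_le_complexity {r : ℕ} {M ε σ : ℝ} {n d : ℕ} (hσ : 0 < σ) (hεσ : ε < σ)
    (h : ∀ pts : ℕ → Cube d, ∃ f ∈ tensorClass r M d, (fun x => -f x) ∈ tensorClass r M d ∧
      (∀ k < n, f (pts k) = 0) ∧ ∃ x, σ ≤ |f x|) :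
    ((n + 1 : ℕ) : ℕ∞) ≤ complexity r M ε d := by
  have := volume_unitInterval_isOpenPosMeasure
  refine le_iInf₂ fun N hN => ?_
  rw [Nat.cast_le]
  by_contra! hlt
  have hNn : N ≤ n := by omega
  refine absurd hN (not_le.2 (((ENNReal.ofReal_lt_ofReal_iff hσ).2 hεσ).trans_le ?_))
  refine le_iInf fun m => le_iInf fun hm => le_iInf fun A => ?_
  -- The points are those queried on zero data. Both `f` and `-f` reproduce these data, so they get
  -- the same output, which must be far from one of them.
  obtain ⟨f, hf, hf', h0, x, hx⟩ := h fun k => A.node k (A.values (fun _ => 0) k)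
  have hv : A.values f m = A.values (fun _ => 0) m :=
    A.values_eq_of_forall_eq fun i hi => h0 i (by omega)
  have hv' : A.values (fun x => -f x) m = A.values (fun _ => 0) m :=
    A.values_eq_of_forall_eq fun i hi => by simp [h0 i (by omega)]
  by_contra! hE
  set E := worstCaseError r M A with hEdef
  have hEtop : E ≠ ⊤ := ne_top_of_lt hE
  have hrun : ∀ g ∈ tensorClass r M d,
      ∀ᵐ y ∂(volume : Measure (Cube d)), |g y - A.run g y| ≤ E.toReal := by
    intro g hg
    have h1 : eLpNorm (fun x => g x - A.run g x) ⊤ (volume : Measure (Cube d)) ≤ E :=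
      le_iSup₂ (f := fun (f : Cube d → ℝ) (_ : f ∈ tensorClass r M d) =>
        eLpNorm (fun x => f x - A.run f x) ⊤ (volume : Measure (Cube d))) g hg
    rw [eLpNorm_exponent_top] at h1
    filter_upwards [ae_le_eLpNormEssSup (f := fun x => g x - A.run g x)
      (μ := (volume : Measure (Cube d)))] with y hy
    have h2 := ENNReal.toReal_mono hEtop (hy.trans h1)
    simpa using h2
  have hrunf : A.run f = A.run fun x => -f x := by
    simp only [Algorithm.run, hv, hv']
  have hae : ∀ᵐ y ∂(volume : Measure (Cube d)), |f y| ≤ E.toReal := by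
    filter_upwards [hrun f hf, hrun _ hf'] with y h1 h2
    rw [← hrunf] at h2
    rw [abs_le] at *
    constructor <;> linarith [h1.1, h1.2, h2.1, h2.2]
  have hopen : IsOpen {y | E.toReal < |f y|} :=
    isOpen_lt continuous_const (continuous_of_mem_tensorClass hf).abs
  have hzero : volume {y | E.toReal < |f y|} = 0 := by
    rw [ae_iff] at hae
    simpa using hae
  have hempty := (hopen.measure_eq_zero_iff volume).1 hzero
  have hfx : |f x| ≤ E.toReal := by
    by_contra! hc
    have : x ∈ {y | E.toReal < |f y|} := hc
    rw [hempty] at this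
    exact this
  have := (ENNReal.ofReal_le_ofReal (hx.trans hfx)).trans ENNReal.ofReal_toReal_le
  exact absurd hE (not_lt.2 this)

theorem HasWeakDeriv.neg {k : ℕ} {f g : ℝ → ℝ} (h : HasWeakDeriv k f g) :
    HasWeakDeriv k (fun x => -f x) fun x => -g x := by
  refine ⟨h.1.neg, h.2.1.neg, fun φ h1 h2 h3 => ?_⟩
  simp only [neg_mul, integral_neg]
  rw [h.2.2 φ h1 h2 h3]
  ring

theorem neg_mem_factorClass {r : ℕ} {M : ℝ} {f : ℝ → ℝ} (hf : f ∈ factorClass r M) :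
    (fun x => -f x) ∈ factorClass r M := by
  obtain ⟨⟨hc, hs⟩, hv, g, hg, hgM⟩ := hf
  refine ⟨⟨hc.neg, fun k hk => ?_⟩, fun x hx => ?_, fun x => -g x, hg.neg, ?_⟩
  · obtain ⟨u, hu, hu'⟩ := hs k hk
    exact ⟨fun x => -u x, hu.neg, hu'.neg⟩
  · have := hv x hx
    exact ⟨by linarith [this.2], by linarith [this.1]⟩
  · have := eLpNorm_neg g ⊤ (volume.restrict (Ioo (0 : ℝ) 1))
    exact this.trans_le hgM

theorem neg_mem_tensorClass {r : ℕ} {M : ℝ} {d : ℕ} (hd : 1 ≤ d) {f : Cube d → ℝ}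
    (hf : f ∈ tensorClass r M d) : (fun x => -f x) ∈ tensorClass r M d := by
  classical
  obtain ⟨F, hF, rfl⟩ := hf
  let i₀ : Fin d := ⟨0, hd⟩
  refine ⟨Function.update F i₀ fun x => -F i₀ x, fun i => ?_, ?_⟩
  · rcases eq_or_ne i i₀ with rfl | h
    · rw [Function.update_self]; exact neg_mem_factorClass (hF _)
    · rw [Function.update_of_ne h]; exact hF i
  · ext x
    show -∏ i, F i (x i) = _
    rw [← Finset.mul_prod_erase Finset.univ (fun i => Function.update F i₀ _ i (x i))
        (Finset.mem_univ i₀),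
      ← Finset.mul_prod_erase Finset.univ (fun i => F i (x i)) (Finset.mem_univ i₀),
      Function.update_self, neg_mul]
    congr 2
    exact Finset.prod_congr rfl fun l hl => by
      rw [Function.update_of_ne (Finset.ne_of_mem_erase hl)]

/-! ### Truncated powers in the factor class -/

/-- Integration by parts raises the order of a weak derivative. -/
theorem HasWeakDeriv.succ {k : ℕ} {f g h : ℝ → ℝ} {a : ℝ} (hfg : HasWeakDeriv k f g)
    (hg : Continuous g) (hgh : ∀ x, x ≠ a → HasDerivAt g (h x) x)
    (hh : IntegrableOn h (Ioo 0 1)) : HasWeakDeriv (k + 1) f h := by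
  refine ⟨hfg.1, hh.locallyIntegrableOn, fun φ h1 h2 h3 => ?_⟩
  have hφ' : ContDiff ℝ ((⊤ : ℕ∞) : WithTop ℕ∞) (deriv φ) := (contDiff_infty_iff_deriv.1 h1).2
  have hd := hfg.2.2 (deriv φ) hφ' h2.deriv ((tsupport_deriv_subset).trans h3)
  rw [iteratedDeriv_succ', hd]
  have h0 : ∀ x : ℝ, x ∉ Ioo (0 : ℝ) 1 → φ x = 0 := fun x hx =>
    image_eq_zero_of_notMem_tsupport fun hx' => hx (h3 hx')
  have hint1 : IntegrableOn (fun x => h x * φ x) (Ioo 0 1) := by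
    obtain ⟨C, hC⟩ := h2.exists_bound_of_continuous h1.continuous
    exact hh.mul_bdd h1.continuous.aestronglyMeasurable.restrict
      (Filter.Eventually.of_forall hC)
  have hint2 : IntegrableOn (fun x => g x * deriv φ x) (Ioo 0 1) :=
    ((hg.mul hφ'.continuous).integrableOn_Icc (a := 0) (b := 1)).mono_set Ioo_subset_Icc_self
  -- The product `g φ` is continuous, so one point without derivative is harmless; the boundary
  -- terms vanish with `φ`.
  have hparts := integral_eq_of_hasDerivAt_off_countable_of_le (fun x => g x * φ x)
    (fun x => h x * φ x + g x * deriv φ x) zero_le_one (countable_singleton a)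
    (hg.mul h1.continuous).continuousOn
    (fun x hx => (hgh x hx.2).mul
      ((h1.differentiable (by simp)).differentiableAt.hasDerivAt))
    (by
      rw [intervalIntegrable_iff_integrableOn_Ioo_of_le zero_le_one]
      exact hint1.add hint2)
  rw [h0 0 (by simp), h0 1 (by simp), intervalIntegral.integral_of_le zero_le_one,
    integral_Ioc_eq_integral_Ioo, integral_add hint1 hint2] at hparts
  rw [pow_succ]
  linear_combination (-1 : ℝ) ^ k * hparts

/-- Functions that are `r` times differentiable off a point, with continuous derivatives of order
less than `r`. -/
theorem mem_factorClass_of_hasDerivAt {r : ℕ} (hr : 1 ≤ r) {M a : ℝ} {f : ℕ → ℝ → ℝ}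
    (hc : ∀ k < r, Continuous (f k)) (hd : ∀ k < r, ∀ x, x ≠ a → HasDerivAt (f k) (f (k + 1) x) x)
    (hm : Measurable (f r)) (hb : ∀ x, |f r x| ≤ M)
    (hv : ∀ x ∈ Icc (0 : ℝ) 1, f 0 x ∈ Icc (-1 : ℝ) 1) : f 0 ∈ factorClass r M := by
  have hmem : ∀ k ≤ r, MemLp (f k) ⊤ (volume.restrict (Ioo (0 : ℝ) 1)) := by
    intro k hk
    rcases hk.lt_or_eq with hk | rfl
    · obtain ⟨C, hC⟩ := isCompact_Icc.exists_bound_of_continuousOn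
        ((hc k hk).continuousOn (s := Icc (0 : ℝ) 1))
      exact memLp_top_of_bound (hc k hk).aestronglyMeasurable.restrict C
        ((ae_restrict_iff' measurableSet_Ioo).2
          (Filter.Eventually.of_forall fun x hx => hC x (Ioo_subset_Icc_self hx)))
    · exact memLp_top_of_bound hm.aestronglyMeasurable M (Filter.Eventually.of_forall hb)
  have hint : ∀ k ≤ r, IntegrableOn (f k) (Ioo 0 1) := fun k hk =>
    (hmem k hk).integrable le_top
  have hw : ∀ k ≤ r, HasWeakDeriv k (f 0) (f k) := by
    intro k
    induction k with
    | zero =>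
      intro _
      exact ⟨(hint 0 (by omega)).locallyIntegrableOn, (hint 0 (by omega)).locallyIntegrableOn,
        fun φ _ _ _ => by simp⟩
    | succ k ih =>
      intro hk
      exact (ih (by omega)).succ (hc k (by omega)) (hd k (by omega)) (hint _ hk)
  refine ⟨⟨(hc 0 (by omega)).continuousOn, fun k hk => ⟨f k, hw k hk, hmem k hk⟩⟩, hv, f r,
    hw r le_rfl, ?_⟩
  rw [eLpNorm_exponent_top]
  exact eLpNormEssSup_le_of_ae_bound (Filter.Eventually.of_forall hb)

theorem one_mem_factorClass {r : ℕ} (hr : 1 ≤ r) {M : ℝ} (hM : 0 ≤ M) :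
    (fun _ => 1) ∈ factorClass r M := by
  let f : ℕ → ℝ → ℝ := fun k _ => if k = 0 then 1 else 0
  refine mem_factorClass_of_hasDerivAt hr (a := 0) (f := f) (fun _ _ => continuous_const)
    (fun k _ x _ => ?_) measurable_const (fun x => ?_) (fun _ _ => ?_)
  · have : f (k + 1) x = 0 := if_neg k.succ_ne_zero
    rw [this]
    exact hasDerivAt_const x _
  · have : f r x = 0 := if_neg (by omega)
    rw [this, abs_zero]
    exact hM
  · simp [f]

/-- The truncated power `C (e (x - a))₊ ^ r`; the sign `e = ±1` selects the side. -/
noncomputable def truncPow (r : ℕ) (C e a x : ℝ) : ℝ :=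
  if 0 < e * (x - a) then C * (e * (x - a)) ^ r else 0

/-- Differentiation lowers the degree of the truncated power: below order `r` the derivatives are
continuous, and at order `r` a step of height `C r!` remains. -/
theorem truncPow_mem_factorClass {r : ℕ} (hr : 1 ≤ r) {M C e a : ℝ} (he : |e| = 1) (hC : 0 ≤ C)
    (hCM : C * r.factorial ≤ M)
    (h1 : ∀ x ∈ Icc (0 : ℝ) 1, 0 < e * (x - a) → C * (e * (x - a)) ^ r ≤ 1) :
    truncPow r C e a ∈ factorClass r M := by
  let f : ℕ → ℝ → ℝ := fun k x =>
    if 0 < e * (x - a) then C * e ^ k * r.descFactorial k * (e * (x - a)) ^ (r - k) else 0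
  have hf0 : f 0 = truncPow r C e a := by
    ext x
    simp [f, truncPow]
  have he0 : e ≠ 0 := by
    rintro rfl
    simp at he
  rw [← hf0]
  refine mem_factorClass_of_hasDerivAt hr (a := a) (fun k hk => ?_) (fun k hk x hx => ?_) ?_
    (fun x => ?_) fun x hx => ?_
  · have h2 : f k = fun x => C * e ^ k * r.descFactorial k * (max (e * (x - a)) 0) ^ (r - k) := by
      ext x
      simp only [f]
      split_ifs with h
      · rw [max_eq_left h.le]
      · rw [max_eq_right (not_lt.1 h), zero_pow (by omega), mul_zero]
    rw [h2]
    fun_prop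
  · rcases lt_or_gt_of_ne (mul_ne_zero he0 (sub_ne_zero.2 hx)) with h | h
    · have h2 : f (k + 1) x = 0 := if_neg (not_lt.2 h.le)
      rw [h2]
      refine (hasDerivAt_const x (0 : ℝ)).congr_of_eventuallyEq ?_
      have h3 : ∀ᶠ y in nhds x, e * (y - a) < 0 :=
        (by fun_prop : Continuous fun y : ℝ => e * (y - a)).continuousAt.eventually_lt_const h
      filter_upwards [h3] with y hy
      exact if_neg (not_lt.2 hy.le)
    · have h2 : f (k + 1) x
          = C * e ^ (k + 1) * r.descFactorial (k + 1) * (e * (x - a)) ^ (r - (k + 1)) := if_pos h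
      rw [h2]
      have h4 : HasDerivAt (fun y => C * e ^ k * r.descFactorial k * (e * (y - a)) ^ (r - k))
          (C * e ^ (k + 1) * r.descFactorial (k + 1) * (e * (x - a)) ^ (r - (k + 1))) x := by
        have h5 : HasDerivAt (fun y => e * (y - a)) e x := by
          simpa using ((hasDerivAt_id x).sub_const a).const_mul e
        have h6 := (h5.pow (r - k)).const_mul (C * e ^ k * r.descFactorial k)
        refine h6.congr_deriv ?_
        rw [Nat.descFactorial_succ, Nat.sub_sub]
        push_cast
        ring
      refine h4.congr_of_eventuallyEq ?_
      have h3 : ∀ᶠ y in nhds x, 0 < e * (y - a) :=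
        (by fun_prop : Continuous fun y : ℝ => e * (y - a)).continuousAt.eventually_const_lt h
      filter_upwards [h3] with y hy
      exact if_pos hy
  · refine Measurable.ite ?_ (by fun_prop) measurable_const
    exact measurableSet_lt measurable_const (by fun_prop)
  · have hM : 0 ≤ C * r.factorial := by positivity
    simp only [f]
    split_ifs
    · rw [Nat.sub_self, pow_zero, mul_one, abs_mul, abs_mul, abs_pow, he, one_pow, mul_one,
        abs_of_nonneg hC, Nat.descFactorial_self, abs_of_nonneg (by positivity)]
      exact hCM
    · simpa using hM.trans hCM
  · rw [hf0, truncPow]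
    split_ifs with h
    · exact ⟨by linarith [mul_nonneg hC (pow_nonneg h.le r)], h1 x hx h⟩
    · norm_num

/-! ### Lower bounds for the complexity -/

/-- Tensor products of one-sided truncated powers have disjoint supports, hence many function
values are needed. -/
theorem card_le_complexity {r d k : ℕ} (hr : 1 ≤ r) (hd : 1 ≤ d) {M ε C a : ℝ} (hC : 0 < C)
    (hCM : C * r.factorial ≤ M) (ha : 0 < a) (ha1 : a < 1) (haC : C * a ^ r = 1)
    (hβ : C * (1 - a) ^ r ≤ 1) (ι : Finset (Finset (Fin d))) (hι : ∀ K ∈ ι, K.card ≤ k)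
    (hε : ε < (C * (1 - a) ^ r) ^ k) : ((ι.card : ℕ) : ℕ∞) ≤ complexity r M ε d := by
  classical
  have ha' : 0 < 1 - a := by linarith
  set β := C * (1 - a) ^ r with hβdef
  have hβ0 : 0 < β := by positivity
  rcases Nat.eq_zero_or_pos ι.card with h0 | hpos
  · simp [h0]
  obtain ⟨n, hn⟩ := Nat.exists_eq_add_of_le' hpos
  rw [hn]
  refine succ_le_complexity (σ := β ^ k) (by positivity) hε fun pts => ?_
  -- `pat z` is the only set whose tensor can be nonzero at `z`, so `n` points leave one of the `n +
  -- 1` sets untouched.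
  let pat : Cube d → Finset (Fin d) := fun z => Finset.univ.filter fun i => a < z i
  obtain ⟨K, hK, hKp⟩ : ∃ K ∈ ι, K ∉ (Finset.range n).image fun k => pat (pts k) := by
    by_contra! h
    have h1 := Finset.card_le_card (show ι ⊆ _ from h)
    have h2 := (Finset.card_image_le (s := Finset.range n) (f := fun k => pat (pts k)))
    rw [Finset.card_range] at h2
    omega
  let F : Fin d → ℝ → ℝ := fun i => if i ∈ K then truncPow r C 1 a else truncPow r C (-1) a
  have hF : ∀ i, F i ∈ factorClass r M := by
    intro i
    simp only [F]
    split_ifs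
    · refine truncPow_mem_factorClass hr (by simp) hC.le hCM fun x hx h => le_trans ?_ hβ
      rw [one_mul] at *
      rw [hβdef]
      gcongr
      exact hx.2
    · refine truncPow_mem_factorClass hr (by simp) hC.le hCM fun x hx h =>
        le_of_le_of_eq ?_ haC
      gcongr
      linarith [hx.1]
  have hf : (fun x : Cube d => ∏ i, F i (x i)) ∈ tensorClass r M d := ⟨F, hF, rfl⟩
  refine ⟨_, hf, neg_mem_tensorClass hd hf, fun k hk => ?_, fun i => if i ∈ K then 1 else 0, ?_⟩
  · by_contra hne
    refine hKp (Finset.mem_image.2 ⟨k, Finset.mem_range.2 hk, ?_⟩)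
    ext i
    have h1 := Finset.prod_ne_zero_iff.1 hne i (Finset.mem_univ i)
    simp only [F] at h1
    simp only [pat, Finset.mem_filter, Finset.mem_univ, true_and]
    by_cases hi : i ∈ K
    · rw [if_pos hi] at h1
      have h2 : 0 < 1 * ((pts k i : ℝ) - a) := by
        by_contra h
        exact h1 (if_neg h)
      exact iff_of_true (by linarith) hi
    · rw [if_neg hi] at h1
      have h2 : 0 < -1 * ((pts k i : ℝ) - a) := by
        by_contra h
        exact h1 (if_neg h)
      exact iff_of_false (by linarith) hi
  -- At this vertex of the cube the right pieces equal `β` and the left pieces equal 1, so the value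
  -- is `β ^ K.card`.
  · have h1 : ∀ i, F i (((if i ∈ K then 1 else 0 : unitInterval)) : ℝ) = if i ∈ K then β else 1 := by
      intro i
      simp only [F]
      split_ifs
      · rw [truncPow, if_pos (by simpa using ha1)]
        simp [hβdef]
      · rw [truncPow, if_pos (by simpa using ha)]
        simpa using haC
    simp only [h1]
    rw [Finset.prod_ite, Finset.prod_const, Finset.prod_const_one, mul_one,
      Finset.filter_mem_eq_inter, Finset.univ_inter, abs_of_pos (by positivity)]
    exact pow_le_pow_of_le_one hβ0.le hβ (hι K hK)

/-- With `C = 2^r` and `a = 1/2` the left and right pieces both reach 1, so all `2^d` tensors have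
norm 1. -/
theorem curseOfDimensionality {r : ℕ} (hr : 1 ≤ r) {M : ℝ} (hM : 2 ^ r * r.factorial ≤ M) :
    CurseOfDimensionality r M := by
  refine ⟨1 / 2, by norm_num, 1, one_pos, 2, one_lt_two, fun d hd => ?_⟩
  have h2 : (2 : ℝ) ^ r * (1 / 2) ^ r = 1 := by
    rw [← mul_pow]; norm_num
  have h3 : (2 : ℝ) ^ r * (1 - 1 / 2) ^ r = 1 := by
    rw [sub_half, h2]
  have h := card_le_complexity (ε := 1 / 2) (k := d) (a := 1 / 2) hr hd (by positivity) hM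
    (by norm_num) (by norm_num) h2 h3.le Finset.univ
    (fun K _ => (Finset.card_le_univ K).trans (Fintype.card_fin d).le)
    (by rw [h3]; norm_num)
  rw [Finset.card_univ, Fintype.card_finset, Fintype.card_fin] at h
  rw [one_mul]
  calc ENNReal.ofReal (2 ^ d) = (((2 ^ d : ℕ) : ℕ∞) : ℝ≥0∞) := by
        rw [ENat.toENNReal_coe, ← ENNReal.ofReal_natCast]
        norm_num
    _ ≤ _ := ENat.toENNReal_le.2 h

theorem cast_le_of_le_complexity {r d n : ℕ} {M ε y : ℝ} (hy : 0 ≤ y)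
    (h1 : ((n : ℕ) : ℕ∞) ≤ complexity r M ε d)
    (h2 : (complexity r M ε d : ℝ≥0∞) ≤ ENNReal.ofReal y) : (n : ℝ) ≤ y := by
  have h3 := (ENat.toENNReal_le.2 h1).trans h2
  rw [ENat.toENNReal_coe, ← ENNReal.ofReal_natCast, ENNReal.ofReal_le_ofReal_iff hy] at h3
  exact h3

/-- For `a = κ^(-1/r)` left pieces reach 1 and right pieces reach `β > 0`. Using exactly `k > q`
right pieces gives `d.choose k` disjointly supported tensors of norm `β^k`, independent of `d`,
which outgrows `d^q`. -/
theorem not_polynomiallyTractable {r : ℕ} (hr : 1 ≤ r) {M : ℝ} (hM : (r.factorial : ℝ) < M)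
    (hMr : M < 2 ^ r * r.factorial) : ¬ PolynomiallyTractable r M := by
  rintro ⟨c, hc, q, hq, p, hp, h⟩
  have hfac : (0 : ℝ) < r.factorial := by exact_mod_cast r.factorial_pos
  set κ := M / r.factorial with hκdef
  have hκ1 : 1 < κ := by rwa [hκdef, one_lt_div hfac]
  have hκ2 : κ < 2 ^ r := by rwa [hκdef, div_lt_iff₀ hfac]
  have hκ0 : 0 < κ := by linarith
  have hr0 : r ≠ 0 := by omega
  set a := κ⁻¹ ^ ((r : ℝ)⁻¹) with hadef
  have har : a ^ r = κ⁻¹ := Real.rpow_inv_natCast_pow (by positivity) hr0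
  have ha0 : 0 < a := by positivity
  have ha1 : a < 1 := by
    by_contra! hle
    have := one_le_pow₀ (n := r) hle
    rw [har] at this
    exact absurd this (not_le.2 (inv_lt_one_of_one_lt₀ hκ1))
  have ha2 : 1 / 2 < a := by
    refine lt_of_pow_lt_pow_left₀ r ha0.le ?_
    rw [har, div_pow, one_pow, one_div]
    exact inv_strictAnti₀ hκ0 hκ2
  have haκ : κ * a ^ r = 1 := by rw [har, mul_inv_cancel₀ hκ0.ne']
  have hβ0 : 0 < κ * (1 - a) ^ r := mul_pos hκ0 (pow_pos (by linarith) _)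
  have hβ1 : κ * (1 - a) ^ r ≤ 1 := by
    rw [← haκ]
    gcongr
    · linarith
    · linarith
  set β := κ * (1 - a) ^ r with hβdef
  set k := ⌈q⌉₊ + 1 with hk
  have hkq : q + 1 ≤ k := by
    rw [hk]; push_cast; linarith [Nat.le_ceil q]
  set ε := β ^ k / 2 with hεdef
  have hβk : β ^ k ≤ 1 := pow_le_one₀ hβ0.le hβ1
  have hβk0 : 0 < β ^ k := by positivity
  have hε : ε ∈ Ioo (0 : ℝ) 1 := ⟨by positivity, by linarith⟩
  have hC1 : 0 ≤ c * ε ^ (-p) := mul_nonneg hc.le (Real.rpow_nonneg hε.1.le _)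
  set C₁ := c * ε ^ (-p) with hC₁
  obtain ⟨d, hd⟩ := exists_nat_gt (max (2 * k : ℝ) (2 ^ k * k.factorial * C₁))
  have hd1 : 2 * k < d := by exact_mod_cast (le_max_left _ _).trans_lt hd
  have hd2 : 2 ^ k * k.factorial * C₁ < d := (le_max_right _ _).trans_lt hd
  have hd0 : 1 ≤ d := by omega
  have hd' : (1 : ℝ) ≤ d := by exact_mod_cast hd0
  have h1 := card_le_complexity (ε := ε) (k := k) (M := M) hr hd0 hκ0
    (by rw [hκdef, div_mul_cancel₀ _ hfac.ne']) ha0 ha1 haκ hβ1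
    (Finset.powersetCard k Finset.univ) (fun K hK => (Finset.mem_powersetCard.1 hK).2.le)
    (by linarith)
  rw [Finset.card_powersetCard, Finset.card_univ, Fintype.card_fin] at h1
  have h2 := cast_le_of_le_complexity (by positivity) h1 (h ε hε d hd0)
  have h3 : ((d + 1 - k : ℕ) : ℝ) ^ k ≤ k.factorial * d.choose k := by
    have := Nat.pow_sub_le_descFactorial d k
    rw [Nat.descFactorial_eq_factorial_mul_choose] at this
    exact_mod_cast this
  have h4 : (d : ℝ) / 2 ≤ ((d + 1 - k : ℕ) : ℝ) := by
    rw [div_le_iff₀ two_pos]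
    exact_mod_cast (by omega : d ≤ (d + 1 - k) * 2)
  have h5 : (d : ℝ) * d ^ q ≤ d ^ k := by
    rw [← Real.rpow_natCast (d : ℝ) k]
    calc (d : ℝ) * d ^ q = d ^ (q + 1) := by
          rw [Real.rpow_add_one (by positivity), mul_comm]
      _ ≤ _ := Real.rpow_le_rpow_of_exponent_le hd' hkq
  have h6 : (d : ℝ) ^ k ≤ 2 ^ k * k.factorial * C₁ * d ^ q := by
    have h7 : ((d : ℝ) / 2) ^ k ≤ k.factorial * (C₁ * d ^ q) := by
      calc ((d : ℝ) / 2) ^ k ≤ ((d + 1 - k : ℕ) : ℝ) ^ k := by gcongr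
        _ ≤ _ := h3
        _ ≤ _ := by gcongr
    rw [div_pow, div_le_iff₀ (by positivity)] at h7
    linarith
  have h8 : (d : ℝ) * d ^ q ≤ 2 ^ k * k.factorial * C₁ * d ^ q := h5.trans h6
  have h9 := le_of_mul_le_mul_right h8 (by positivity)
  linarith

/-- The complexity grows at least logarithmically with the dimension. -/
theorem succ_le_complexity_of_two_pow_lt {r n d : ℕ} (hr : 1 ≤ r) (hn : 2 ^ n < d) {M C ε : ℝ}
    (hC : 0 < C) (hCM : C * r.factorial ≤ M) (hC1 : C * (1 / 2) ^ r ≤ 1)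
    (hε : ε < (C * (1 / 2) ^ r) ^ 2) : ((n + 1 : ℕ) : ℕ∞) ≤ complexity r M ε d := by
  classical
  have hM : 0 ≤ M := le_trans (by positivity) hCM
  refine succ_le_complexity (σ := (C * (1 / 2) ^ r) ^ 2) (by positivity) hε fun pts => ?_
  -- Pigeonhole: two coordinates lie on the same side of 1/2 at every sample point, so a right piece
  -- in `i` times a left piece in `j` vanishes at all of them.
  obtain ⟨i, j, hij, hpat⟩ := Fintype.exists_ne_map_eq_of_card_lt
    (fun (i : Fin d) (k : Fin n) => decide ((1 / 2 : ℝ) < pts k i)) (by simpa using hn)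
  have hp : truncPow r C 1 (1 / 2) ∈ factorClass r M :=
    truncPow_mem_factorClass hr (by simp) hC.le hCM fun x hx h => le_trans (by
      gcongr
      linarith [hx.2]) hC1
  have hm : truncPow r C (-1) (1 / 2) ∈ factorClass r M :=
    truncPow_mem_factorClass hr (by simp) hC.le hCM fun x hx h => le_trans (by
      gcongr
      linarith [hx.1]) hC1
  let F : Fin d → ℝ → ℝ := fun l => if l = i then truncPow r C 1 (1 / 2) else
    if l = j then truncPow r C (-1) (1 / 2) else fun _ => 1
  have hF : ∀ l, F l ∈ factorClass r M := by
    intro l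
    simp only [F]
    split_ifs
    exacts [hp, hm, one_mem_factorClass hr hM]
  have hFi : F i = truncPow r C 1 (1 / 2) := if_pos rfl
  have hFj : F j = truncPow r C (-1) (1 / 2) := by simp [F, hij.symm]
  have hf : (fun x : Cube d => ∏ l, F l (x l)) ∈ tensorClass r M d := ⟨F, hF, rfl⟩
  refine ⟨_, hf, neg_mem_tensorClass (by have := Nat.one_le_two_pow (n := n); omega) hf,
    fun k hk => ?_, fun l => if l = i then 1 else 0, ?_⟩
  · have h1 := congrFun hpat ⟨k, hk⟩
    simp only [decide_eq_decide] at h1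
    by_cases h2 : (1 / 2 : ℝ) < pts k i
    · refine Finset.prod_eq_zero (Finset.mem_univ j) ?_
      rw [hFj, truncPow, if_neg]
      have := h1.1 h2
      linarith
    · refine Finset.prod_eq_zero (Finset.mem_univ i) ?_
      rw [hFi, truncPow, if_neg]
      linarith
  · have h1 : ∀ l, F l (((if l = i then 1 else 0 : unitInterval)) : ℝ)
        = (if l = i then C * (1 / 2) ^ r else 1) * (if l = j then C * (1 / 2) ^ r else 1) := by
      intro l
      by_cases h2 : l = i
      · subst h2
        simp only [if_true, if_neg hij, hFi, truncPow]
        norm_num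
      · by_cases h3 : l = j
        · subst h3
          simp only [if_true, if_neg h2, hFj, truncPow]
          norm_num
        · simp [F, h2, h3]
    simp only [h1]
    rw [Finset.prod_mul_distrib, Finset.prod_ite_eq', Finset.prod_ite_eq']
    simp only [Finset.mem_univ, if_true]
    rw [abs_of_pos (by positivity), sq]

/-- Two nontrivial factors keep the norm at `β²` for every `d`, so at one fixed `ε` the complexity
is unbounded in `d`. -/
theorem not_stronglyPolynomiallyTractable {r : ℕ} (hr : 1 ≤ r) {M : ℝ} (hM : 0 < M)
    (hMr : M ≤ r.factorial) : ¬ StronglyPolynomiallyTractable r M := by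
  rintro ⟨c, hc, p, hp, h⟩
  have hfac : (0 : ℝ) < r.factorial := by exact_mod_cast r.factorial_pos
  have hκ0 : 0 < M / r.factorial := by positivity
  have hκ : M / r.factorial * (1 / 2) ^ r ≤ 1 :=
    mul_le_one₀ (div_le_one_of_le₀ hMr hfac.le) (by positivity)
      (pow_le_one₀ (by norm_num) (by norm_num))
  set β := M / r.factorial * (1 / 2) ^ r with hβ
  have hβ0 : 0 < β := by positivity
  have hβ2 : β ^ 2 ≤ 1 := pow_le_one₀ hβ0.le hκ
  have hβ20 : 0 < β ^ 2 := by positivity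
  have hε : β ^ 2 / 2 ∈ Ioo (0 : ℝ) 1 := ⟨by positivity, by linarith⟩
  have hy : 0 ≤ c * (β ^ 2 / 2) ^ (-p) := by positivity
  set y := c * (β ^ 2 / 2) ^ (-p)
  have h1 := succ_le_complexity_of_two_pow_lt (n := ⌈y⌉₊) (d := 2 ^ ⌈y⌉₊ + 1) (M := M)
    (ε := β ^ 2 / 2) hr (by omega) hκ0 (by rw [div_mul_cancel₀ _ hfac.ne']) hκ (by linarith)
  have h2 := cast_le_of_le_complexity hy h1 (h _ hε _ (Nat.le_add_left 1 _))
  push_cast at h2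
  linarith [Nat.le_ceil y]

/-- For fixed `ε` the quasi-polynomial bound is a constant times `d^τ`, which `α^d` outgrows. -/
theorem QuasiPolynomiallyTractable.not_curseOfDimensionality {r : ℕ} {M : ℝ}
    (h : QuasiPolynomiallyTractable r M) : ¬ CurseOfDimensionality r M := by
  rintro ⟨ε, hε, c, hc, α, hα, hcurse⟩
  obtain ⟨c', hc', t, ht, h⟩ := h
  -- The curse may come with `ε ≥ 1`, where tractability says nothing; decreasing `ε` only increases
  -- the complexity.
  set ε' := min ε (1 / 2) with hε'def
  have hε' : ε' ∈ Ioo (0 : ℝ) 1 :=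
    ⟨lt_min hε (by norm_num), (min_le_right _ _).trans_lt (by norm_num)⟩
  set τ := t * (1 + Real.log ε'⁻¹) with hτ
  have hlog : 0 < Real.log α := Real.log_pos hα
  have hlittle := isLittleO_rpow_exp_pos_mul_atTop τ hlog
  have hev := (hlittle.bound (c := c / (2 * (c' * Real.exp τ))) (by positivity)).natCast_atTop
  obtain ⟨d, hd, hd1⟩ := (hev.and (Filter.eventually_ge_atTop 1)).exists
  have hd' : (1 : ℝ) ≤ d := by exact_mod_cast hd1
  have h1 := (hcurse d hd1).trans ((ENat.toENNReal_le.2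
    (complexity_antitone (min_le_left ε (1 / 2)) d)).trans (h ε' hε' d hd1))
  rw [ENNReal.ofReal_le_ofReal_iff (by positivity)] at h1
  have hα' : α ^ d = Real.exp (Real.log α * d) := by
    rw [mul_comm, Real.exp_nat_mul, Real.exp_log (by linarith)]
  have hdτ : Real.exp (τ * (1 + Real.log d)) = Real.exp τ * (d : ℝ) ^ τ := by
    rw [mul_add, mul_one, Real.exp_add, Real.rpow_def_of_pos (by linarith), mul_comm τ (Real.log _)]
  rw [hα', hdτ] at h1
  rw [Real.norm_of_nonneg (by positivity), Real.norm_of_nonneg (by positivity),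
    div_mul_eq_mul_div, le_div_iff₀ (by positivity)] at hd
  have := Real.exp_pos (Real.log α * d)
  nlinarith [mul_pos hc this]

end RankOneRecovery

theorem theorem2 (r : ℕ) (hr : 1 ≤ r) (M : ℝ) (hM : 0 < M) :
    (RankOneRecovery.CurseOfDimensionality r M ↔ (2 : ℝ) ^ r * (r.factorial : ℝ) ≤ M) ∧
    ((r.factorial : ℝ) < M → M < (2 : ℝ) ^ r * (r.factorial : ℝ) →
      RankOneRecovery.QuasiPolynomiallyTractable r M ∧
        ¬ RankOneRecovery.PolynomiallyTractable r M) ∧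
    (M ≤ (r.factorial : ℝ) →
      RankOneRecovery.PolynomiallyTractable r M ∧
        ¬ RankOneRecovery.StronglyPolynomiallyTractable r M) := by
  refine ⟨⟨fun h => ?_, RankOneRecovery.curseOfDimensionality hr⟩, fun h1 h2 =>
    ⟨RankOneRecovery.quasiPolynomiallyTractable hr hM h2,
      RankOneRecovery.not_polynomiallyTractable hr h1 h2⟩, fun h =>
    ⟨RankOneRecovery.polynomiallyTractable hr hM h,
      RankOneRecovery.not_stronglyPolynomiallyTractable hr hM h⟩⟩
  by_contra! hlt
  exact (RankOneRecovery.quasiPolynomiallyTractable hr hM hlt).not_curseOfDimensionality h
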